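/- Let $k$ be an algebraically closed field. Let $\Delta$ be a finite quiver and let $\mathfrak R$ be a set of relations, i.e. of $k$-linear combinations of paths of length at least $2$ with a common starting vertex and a common terminating vertex, such that $\mathfrak R$ is minimal (no $\rho \in \mathfrak R$ lies in the two-sided ideal of the path algebra $k\Delta$ generated by $\mathfrak R \setminus \{\rho\}$) and, for some $n \ge 1$, every path of length at least $n$ lies in the two-sided ideal $\langle \mathfrak R \rangle$. Put $\Lambda := k\Delta / \langle \mathfrak R\rangle$ and let $\operatorname{mod} \Lambda$ be the category of finite-dimensional left $\Lambda$-modules. For a dimension vector $\mathbf d \in \mathbb N^{\Delta_0}$ let $\operatorname{mod}_\Lambda^{\mathbf d}(k)$ be the variety of all $M = (M_\alpha)_{\alpha \in \Delta_1} \in \prod_{\alpha : a \to b} \mathbb M_{d(b) \times d(a)}(k)$ with $M_\rho = 0$ for each $\rho \in \mathfrak R$, equipped with the Zariski topology. Each such $M$ is regarded as a $\Lambda$-module with underlying space $\bigoplus_{x \in \Delta_0} k^{d(x)}$. Let $\mathcal O_M$ be the orbit of $M$ under the action of $\prod_{x} \operatorname{GL}_{d(x)}(k)$ given by $(g * M)_\alpha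 = g_b M_\alpha g_a^{-1}$ for $\alpha : a \to b$. Bars denote closures in $\operatorname{mod}_\Lambda^{\mathbf d}(k)$. Let $\mathcal L$ and $\mathcal R$ be full subcategories of $\operatorname{mod} \Lambda$, and for each $\mathbf d$ let $\mathcal L(\mathbf d)$ and $\mathcal R(\mathbf d)$ be the sets of those $M \in \operatorname{mod}_\Lambda^{\mathbf d}(k)$ that belong to $\mathcal L$ and to $\mathcal R$, respectively. Assume that $(\mathcal L, \mathcal R)$ is a geometric bisection, that is: 1. $\mathcal L$ and $\mathcal R$ are closed under direct sums and direct summands (in particular, under isomorphisms); 2. every $M \in \operatorname{mod} \Lambda$ is isomorphic to $U \oplus V$ for some $U \in \mathcal L$ and $V \in \mathcal R$; 3. $\operatorname{pdim}_\Lambda U \le 1$ for each $U \in \mathcal L$, and $\operatorname{idim}_\Lambda V \le 1$ for each $V \in \mathcal R$; 4. $\operatorname{Hom}_\Lambda(V, U) = 0 = \operatorname{Ext}^1_\Lambda(U, V)$ for all $U \in \mathcal L$ and $V \in \mathcal R$; 5. for each $\mathbf d$, the sets $\mathcal L(\mathbf d)$ and $\mathcal R(\mathbf d)$ are open in $\operatorname{mod}_\Lambda^{\mathbf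 d}(k)$ and, if nonempty, irreducible. Assume moreover that $(\mathcal L, \mathcal R)$ is determined by a family $(H_x)_{x \in \mathbb X}$ in $\operatorname{mod} \Lambda$, that is, for each dimension vector $\mathbf d$, $$\mathcal L(\mathbf d) = \bigcup_{x \in \mathbb X} \{ M \in \operatorname{mod}_\Lambda^{\mathbf d}(k) : \operatorname{Hom}_\Lambda(H_x, M) = 0 \}, \qquad \mathcal R(\mathbf d) = \bigcap_{x \in \mathbb X} \{ M \in \operatorname{mod}_\Lambda^{\mathbf d}(k) : \operatorname{Ext}^1_\Lambda(H_x, M) = 0 \}.$$ Let $\mathbf d$ be a dimension vector such that $\mathcal U := \mathcal L(\mathbf d) \neq \emptyset$. Then for every $N \in \overline{\mathcal U}$ there exists $M \in \mathcal U$ such that $N \in \overline{\mathcal O}_M$; in other words, $$\overline{\mathcal U} = \bigcup_{M \in \mathcal U} \overline{\mathcal O}_M.$$ -/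

import Mathlib

/-! ## The path algebra of a quiver

`Δ` is a quiver with finitely many vertices and arrows.  In Mathlib a path `p : Path a b` starts
at `a` and ends at `b`, and `p.comp q` traverses `p` first.  The product of the path algebra is
written in the opposite order (`σ' * σ''` traverses `σ''` first), so that left modules are
covariant representations. -/

universe u v

/-- The path algebra `kΔ`: the vector space with basis all the paths in `Δ`. -/
def PathAlgebra (k : Type u) (Δ : Type v) [Quiver.{v} Δ] [Field k] : Type (max u v) :=
  (Σ a b : Δ, Quiver.Path a b) →₀ k

namespace PathAlgebra

section Ring

variable {k : Type u} {Δ : Type v} [Quiver.{v} Δ] [Field k]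

noncomputable instance : AddCommGroup (PathAlgebra k Δ) :=
  inferInstanceAs (AddCommGroup ((Σ a b : Δ, Quiver.Path a b) →₀ k))

noncomputable instance : Module k (PathAlgebra k Δ) :=
  inferInstanceAs (Module k ((Σ a b : Δ, Quiver.Path a b) →₀ k))

/-- A path, as a basis element of the path algebra. -/
noncomputable def ofPath {a b : Δ} (σ : Quiver.Path a b) : PathAlgebra k Δ :=
  Finsupp.single ⟨a, b, σ⟩ 1

/-- The linear map out of the path algebra with prescribed values on the paths. -/
noncomputable def extend {A : Type*} [AddCommGroup A] [Module k A]
    (f : ∀ {a b : Δ}, Quiver.Path a b → A) : PathAlgebra k Δ →ₗ[k] A :=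
  Finsupp.linearCombination k fun p : Σ a b : Δ, Quiver.Path a b => f p.2.2

@[simp] theorem extend_ofPath {A : Type*} [AddCommGroup A] [Module k A]
    (f : ∀ {a b : Δ}, Quiver.Path a b → A) {a b : Δ} (σ : Quiver.Path a b) :
    extend (k := k) f (ofPath σ) = f σ := by
  unfold extend ofPath
  erw [Finsupp.linearCombination_single, one_smul]

theorem hom_ext {A : Type*} [AddCommGroup A] [Module k A] {f g : PathAlgebra k Δ →ₗ[k] A}
    (h : ∀ (a b : Δ) (σ : Quiver.Path a b), f (ofPath σ) = g (ofPath σ)) : f = g := by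
  refine Finsupp.lhom_ext' fun p => LinearMap.ext_ring ?_
  obtain ⟨a, b, σ⟩ := p
  exact h a b σ

variable [DecidableEq Δ]

/-- The product `σ' σ''` of two paths: their composition if `σ''` ends where `σ'` starts,
and `0` otherwise. -/
noncomputable def mulPath {b' c a b : Δ} (σ' : Quiver.Path b' c) (σ'' : Quiver.Path a b) :
    PathAlgebra k Δ :=
  if h : b = b' then ofPath ((σ''.cast rfl h).comp σ') else 0

/-- The multiplication of the path algebra, as a bilinear map. -/
noncomputable def mulHom : PathAlgebra k Δ →ₗ[k] PathAlgebra k Δ →ₗ[k] PathAlgebra k Δ :=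
  extend fun σ' => extend fun σ'' => mulPath σ' σ''

noncomputable instance : Mul (PathAlgebra k Δ) := ⟨fun x y => mulHom x y⟩

theorem mul_def (x y : PathAlgebra k Δ) : x * y = mulHom x y := rfl

theorem ofPath_mul_ofPath {b' c a b : Δ} (σ' : Quiver.Path b' c) (σ'' : Quiver.Path a b) :
    (ofPath σ' * ofPath σ'' : PathAlgebra k Δ) = mulPath σ' σ'' := by
  simp [mul_def, mulHom]

@[simp] theorem ofPath_mul_comp {a b c : Δ} (σ' : Quiver.Path b c) (σ'' : Quiver.Path a b) :
    (ofPath σ' * ofPath σ'' : PathAlgebra k Δ) = ofPath (σ''.comp σ') := by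
  simp [ofPath_mul_ofPath, mulPath]

theorem ofPath_mul_of_ne {b' c a b : Δ} (σ' : Quiver.Path b' c) (σ'' : Quiver.Path a b)
    (h : b ≠ b') : (ofPath σ' * ofPath σ'' : PathAlgebra k Δ) = 0 := by
  simp [ofPath_mul_ofPath, mulPath, h]

variable [Fintype Δ]

/-- The unit of the path algebra: the sum of the paths of length `0`. -/
noncomputable instance : One (PathAlgebra k Δ) :=
  ⟨∑ x : Δ, ofPath (Quiver.Path.nil : Quiver.Path x x)⟩

theorem one_def :
    (1 : PathAlgebra k Δ) = ∑ x : Δ, ofPath (Quiver.Path.nil : Quiver.Path x x) := rfl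

theorem one_mul_aux (x : PathAlgebra k Δ) : 1 * x = x := by
  suffices h : mulHom (1 : PathAlgebra k Δ) = LinearMap.id from congrArg (fun f => f x) h
  refine hom_ext fun a b σ => ?_
  simp only [one_def, map_sum, LinearMap.sum_apply, LinearMap.id_apply]
  rw [Finset.sum_eq_single b]
  · rw [← mul_def, ofPath_mul_comp, Quiver.Path.comp_nil]
  · intro c _ hc
    rw [← mul_def, ofPath_mul_of_ne _ _ hc.symm]
  · simp

theorem mul_one_aux (x : PathAlgebra k Δ) : x * 1 = x := by
  suffices h : mulHom.flip (1 : PathAlgebra k Δ) = LinearMap.id from congrArg (fun f => f x) h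
  refine hom_ext fun a b σ => ?_
  simp only [one_def, map_sum, LinearMap.flip_apply, LinearMap.id_apply, LinearMap.sum_apply]
  rw [Finset.sum_eq_single a]
  · rw [← mul_def, ofPath_mul_comp, Quiver.Path.nil_comp]
  · intro c _ hc
    rw [← mul_def, ofPath_mul_of_ne _ _ hc]
  · simp

theorem ofPath_assoc {a b c d e f : Δ} (p : Quiver.Path e f) (q : Quiver.Path c d)
    (r : Quiver.Path a b) :
    (ofPath p * ofPath q * ofPath r : PathAlgebra k Δ) = ofPath p * (ofPath q * ofPath r) := by
  by_cases h₁ : d = e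
  · subst h₁
    by_cases h₂ : b = c
    · subst h₂
      simp
    · rw [ofPath_mul_comp, ofPath_mul_of_ne _ _ h₂, ofPath_mul_of_ne _ _ h₂]
      simp [mul_def]
  · rw [ofPath_mul_of_ne _ _ h₁]
    by_cases h₂ : b = c
    · subst h₂
      rw [ofPath_mul_comp, ofPath_mul_of_ne _ _ h₁]
      simp [mul_def]
    · rw [ofPath_mul_of_ne _ _ h₂]
      simp [mul_def]

theorem mul_assoc_aux (x y z : PathAlgebra k Δ) : x * y * z = x * (y * z) := by
  let F : PathAlgebra k Δ →ₗ[k] PathAlgebra k Δ →ₗ[k] PathAlgebra k Δ →ₗ[k] PathAlgebra k Δ :=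
    LinearMap.compr₂ mulHom mulHom
  let G : PathAlgebra k Δ →ₗ[k] PathAlgebra k Δ →ₗ[k] PathAlgebra k Δ →ₗ[k] PathAlgebra k Δ :=
    (LinearMap.llcomp k _ _ _ ∘ₗ mulHom).compl₂ mulHom
  suffices h : F = G from congrArg (fun f => f x y z) h
  refine hom_ext fun _ _ p => hom_ext fun _ _ q => hom_ext fun _ _ r => ?_
  exact ofPath_assoc p q r

noncomputable instance : Ring (PathAlgebra k Δ) :=
  { (inferInstance : AddCommGroup (PathAlgebra k Δ)) with
    mul := (· * ·)
    one := 1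
    mul_assoc := mul_assoc_aux
    one_mul := one_mul_aux
    mul_one := mul_one_aux
    left_distrib := fun x y z => map_add (mulHom x) y z
    right_distrib := fun x y z => by simp [mul_def]
    zero_mul := fun x => by simp [mul_def]
    mul_zero := fun x => by simp [mul_def] }

noncomputable instance : Algebra k (PathAlgebra k Δ) :=
  Algebra.ofModule (fun r x y => by simp [mul_def]) (fun r x y => by simp [mul_def])

end Ring

end PathAlgebra

/-! ## Bound quivers and their path algebras -/

section BoundQuiver

variable {k : Type u} {Δ : Type v} [Quiver.{v} Δ] [Field k]

/-- A linear combination of paths from `a` to `b`, as an element of `1_b (kΔ) 1_a ⊆ kΔ`. -/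
noncomputable def relationElement {a b : Δ} (ρ : Quiver.Path a b →₀ k) : PathAlgebra k Δ :=
  ρ.sum fun σ c => c • PathAlgebra.ofPath σ

/-- A set of linear combinations of parallel paths, given as a family indexed by the common
starting and terminating vertices, viewed as a subset of `kΔ`. -/
def relationSet (rel : ∀ a b : Δ, Set (Quiver.Path a b →₀ k)) : Set (PathAlgebra k Δ) :=
  {r | ∃ (a b : Δ) (ρ : Quiver.Path a b →₀ k), ρ ∈ rel a b ∧ r = relationElement ρ}

variable [Fintype Δ] [DecidableEq Δ]

/-- `(Δ, rel)` is a bound quiver: `rel` is a minimal set of relations (linear combinations of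
parallel paths of length `> 1`) and all sufficiently long paths lie in the two-sided ideal
generated by `rel`. -/
structure IsBoundQuiver (rel : ∀ a b : Δ, Set (Quiver.Path a b →₀ k)) : Prop where
  one_lt_length : ∀ (a b : Δ), ∀ ρ ∈ rel a b, ∀ σ ∈ ρ.support, 1 < σ.length
  minimal : ∀ r ∈ relationSet rel, r ∉ TwoSidedIdeal.span (relationSet rel \ {r})
  admissible : ∃ n : ℕ, 0 < n ∧ ∀ (a b : Δ) (σ : Quiver.Path a b), n ≤ σ.length →
    (PathAlgebra.ofPath σ : PathAlgebra k Δ) ∈ TwoSidedIdeal.span (relationSet rel)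

/-- The path algebra `Λ = kΔ / ⟨rel⟩` of `(Δ, rel)`. -/
abbrev BoundPathAlgebra (rel : ∀ a b : Δ, Set (Quiver.Path a b →₀ k)) : Type (max u v) :=
  (TwoSidedIdeal.span (relationSet rel)).ringCon.Quotient

end BoundQuiver

/-! ## The Zariski topology on an affine space -/

/-- The Zariski topology on `k^ι`: closed sets are the zero sets of families of polynomials. -/
@[reducible] def zariskiTopology (k : Type*) [Field k] (ι : Type*) : TopologicalSpace (ι → k) :=
  TopologicalSpace.ofClosed
    {Z | ∃ S : Set (MvPolynomial ι k), Z = {x | ∀ f ∈ S, MvPolynomial.eval x f = 0}}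
    ⟨{1}, by ext x; simp⟩
    (by
      intro A hA
      refine ⟨{f | ∃ Z ∈ A, ∀ x ∈ Z, MvPolynomial.eval x f = 0}, ?_⟩
      ext x
      simp only [Set.mem_sInter, Set.mem_ofPred_eq]
      constructor
      · rintro h f ⟨Z, hZ, hf⟩
        exact hf x (h Z hZ)
      · intro h Z hZ
        obtain ⟨S, rfl⟩ := hA hZ
        exact fun f hf => h f ⟨_, hZ, fun y hy => hy f hf⟩)
    (by
      rintro _ ⟨S, rfl⟩ _ ⟨T, rfl⟩
      refine ⟨{h | ∃ f ∈ S, ∃ g ∈ T, h = f * g}, ?_⟩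
      ext x
      simp only [Set.mem_union, Set.mem_ofPred_eq]
      constructor
      · rintro (h | h) _ ⟨f, hf, g, hg, rfl⟩
        · simp [h f hf]
        · simp [h g hg]
      · intro h
        by_contra! hcon
        obtain ⟨⟨f, hf, hf0⟩, g, hg, hg0⟩ := hcon
        have := h _ ⟨f, hf, g, hg, rfl⟩
        simp [hf0, hg0] at this)

/-! ## Module varieties -/

section ModuleVariety

variable {k : Type u} {Δ : Type v} [Quiver.{v} Δ] [Field k]

/-- The affine space `∏_α M_{d(tα), d(sα)}(k)` of representations of `Δ` with dimension
vector `d`. -/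
abbrev RepSpace (k : Type u) {Δ : Type v} [Quiver.{v} Δ] [Field k] (d : Δ → ℕ) : Type (max u v) :=
  ∀ a b : Δ, (a ⟶ b) → Matrix (Fin (d b)) (Fin (d a)) k

namespace RepSpace

variable {d : Δ → ℕ}

/-- The matrix `M_σ` of a path `σ`. -/
def pathMatrix (M : RepSpace k d) {a : Δ} :
    {b : Δ} → Quiver.Path a b → Matrix (Fin (d b)) (Fin (d a)) k
  | _, .nil => 1
  | _, .cons σ α => M _ _ α * pathMatrix M σ

/-- The matrix `M_ρ` of a linear combination `ρ` of parallel paths. -/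
noncomputable def relMatrix (M : RepSpace k d) {a b : Δ} (ρ : Quiver.Path a b →₀ k) :
    Matrix (Fin (d b)) (Fin (d a)) k :=
  ρ.sum fun σ c => c • M.pathMatrix σ

/-- The matrix entries of a point of the affine space, as a function on the set of coordinates. -/
def coords (M : RepSpace k d) : (Σ a b : Δ, (a ⟶ b) × Fin (d b) × Fin (d a)) → k :=
  fun i => M i.1 i.2.1 i.2.2.1 i.2.2.2.1 i.2.2.2.2

theorem pathMatrix_comp (M : RepSpace k d) {a b c : Δ} (σ : Quiver.Path a b)
    (τ : Quiver.Path b c) : M.pathMatrix (σ.comp τ) = M.pathMatrix τ * M.pathMatrix σ := by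
  induction τ with
  | nil => simp [pathMatrix]
  | cons τ α ih => simp [pathMatrix, ih, Matrix.mul_assoc]

variable [DecidableEq Δ]

/-- The action of a path `σ : a → b` on `⨁_x k^{d(x)}`: it maps the `a`-th summand to the
`b`-th by `M_σ` and kills the other summands. -/
noncomputable def pathEnd (M : RepSpace k d) {a b : Δ} (σ : Quiver.Path a b) :
    Module.End k (∀ x : Δ, Fin (d x) → k) :=
  LinearMap.single k (fun x : Δ => Fin (d x) → k) b ∘ₗ (M.pathMatrix σ).mulVecLin ∘ₗ
    LinearMap.proj a

theorem pathEnd_mul (M : RepSpace k d) {b' c a b : Δ} (σ' : Quiver.Path b' c)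
    (σ'' : Quiver.Path a b) :
    PathAlgebra.extend (k := k) (fun σ => M.pathEnd σ)
      (PathAlgebra.ofPath σ' * PathAlgebra.ofPath σ'') = M.pathEnd σ' * M.pathEnd σ'' := by
  by_cases h : b = b'
  · subst h
    rw [PathAlgebra.ofPath_mul_comp, PathAlgebra.extend_ofPath]
    refine LinearMap.ext fun v => ?_
    simp [pathEnd, pathMatrix_comp, Matrix.mulVec_mulVec]
  · rw [PathAlgebra.ofPath_mul_of_ne _ _ h, map_zero]
    refine LinearMap.ext fun v => ?_
    simp [pathEnd, Pi.single_eq_of_ne (Ne.symm h)]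

variable [Fintype Δ]

/-- The action of the path algebra `kΔ` on `⨁_x k^{d(x)}` defined by `M`. -/
noncomputable def act (M : RepSpace k d) :
    PathAlgebra k Δ →ₐ[k] Module.End k (∀ x : Δ, Fin (d x) → k) :=
  AlgHom.ofLinearMap (PathAlgebra.extend fun σ => M.pathEnd σ)
    (by
      rw [PathAlgebra.one_def, map_sum]
      refine LinearMap.ext fun v => ?_
      simp only [PathAlgebra.extend_ofPath, LinearMap.sum_apply]
      have : ∀ x : Δ, M.pathEnd (Quiver.Path.nil : Quiver.Path x x) v = Pi.single x (v x) := by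
        intro x
        simp [pathEnd, pathMatrix]
      simp only [this]
      exact Finset.univ_sum_single v)
    (by
      intro x y
      let E : PathAlgebra k Δ →ₗ[k] Module.End k (∀ x : Δ, Fin (d x) → k) :=
        PathAlgebra.extend fun σ => M.pathEnd σ
      suffices h : (PathAlgebra.mulHom (k := k) (Δ := Δ)).compr₂ E =
          (LinearMap.mul k _).compl₁₂ E E from congrArg (fun f => f x y) h
      refine PathAlgebra.hom_ext fun _ _ p => PathAlgebra.hom_ext fun _ _ q => ?_
      have := M.pathEnd_mul p q
      simpa [E, PathAlgebra.mul_def] using this)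

theorem act_ofPath (M : RepSpace k d) {a b : Δ} (σ : Quiver.Path a b) :
    M.act (PathAlgebra.ofPath σ) = M.pathEnd σ :=
  PathAlgebra.extend_ofPath _ σ

theorem act_relationElement (M : RepSpace k d) {a b : Δ} (ρ : Quiver.Path a b →₀ k)
    (hρ : M.relMatrix ρ = 0) : M.act (relationElement ρ) = 0 := by
  have h : M.act (relationElement ρ) =
      LinearMap.single k (fun x : Δ => Fin (d x) → k) b ∘ₗ (M.relMatrix ρ).mulVecLin ∘ₗ
        LinearMap.proj a := by
    refine LinearMap.ext fun v => ?_
    simp only [relationElement, relMatrix, Finsupp.sum, map_sum, map_smul, act_ofPath, pathEnd,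
      LinearMap.sum_apply, LinearMap.smul_apply, LinearMap.comp_apply, LinearMap.proj_apply,
      Matrix.mulVecLin_apply, Matrix.sum_mulVec, Matrix.smul_mulVec]
  rw [h, hρ]
  ext
  simp

end RepSpace

variable (rel : ∀ a b : Δ, Set (Quiver.Path a b →₀ k))

/-- The variety `mod_Λ^d(k)` of representations of `(Δ, rel)` with dimension vector `d`. -/
def ModVariety (d : Δ → ℕ) : Type (max u v) :=
  {M : RepSpace k d // ∀ (a b : Δ), ∀ ρ ∈ rel a b, M.relMatrix ρ = 0}

variable {rel}

namespace ModVariety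

variable {d : Δ → ℕ}

/-- `mod_Λ^d(k)` carries the Zariski topology of the surrounding affine space. -/
instance : TopologicalSpace (ModVariety rel d) :=
  TopologicalSpace.induced (fun M => M.1.coords) (zariskiTopology k _)

/-- The orbit `O_M` under `GL_d(k) = ∏_x GL_{d(x)}(k)`, acting by
`(g * M)_α = g_{tα} M_α g_{sα}⁻¹`. -/
def orbit (M : ModVariety rel d) : Set (ModVariety rel d) :=
  {N | ∃ g : ∀ x : Δ, Matrix.GeneralLinearGroup (Fin (d x)) k, ∀ (a b : Δ) (α : a ⟶ b),
    N.1 a b α = (g b).1 * M.1 a b α * ((g a)⁻¹).1}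

/-- The vector space `⨁_x k^{d(x)}` underlying the `Λ`-module given by `M`. -/
def Carrier (_M : ModVariety rel d) : Type (max u v) := ∀ x : Δ, Fin (d x) → k

noncomputable instance (M : ModVariety rel d) : AddCommGroup M.Carrier :=
  inferInstanceAs (AddCommGroup (∀ x : Δ, Fin (d x) → k))

noncomputable instance (M : ModVariety rel d) : Module k M.Carrier :=
  inferInstanceAs (Module k (∀ x : Δ, Fin (d x) → k))

variable [Fintype Δ] [DecidableEq Δ]

/-- The action of `Λ` on `⨁_x k^{d(x)}` defined by `M`. -/
noncomputable def act (M : ModVariety rel d) : BoundPathAlgebra rel →ₐ[k] Module.End k M.Carrier :=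
  RingCon.liftₐ _ (show PathAlgebra k Δ →ₐ[k] Module.End k M.Carrier from M.1.act) (by
    intro x y hxy
    have h₁ : x - y ∈ TwoSidedIdeal.span (relationSet rel) :=
      (TwoSidedIdeal.rel_iff _ x y).1 hxy
    have h₂ := TwoSidedIdeal.mem_span_iff.1 h₁ (TwoSidedIdeal.ker M.1.act) (by
      rintro _ ⟨a, b, ρ, hρ, rfl⟩
      exact (TwoSidedIdeal.mem_ker _).2 (M.1.act_relationElement ρ (M.2 a b ρ hρ)))
    have h₃ : M.1.act (x - y) = 0 := (TwoSidedIdeal.mem_ker _).1 h₂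
    rw [map_sub] at h₃
    exact sub_eq_zero.1 h₃)

noncomputable instance (M : ModVariety rel d) : Module (BoundPathAlgebra rel) M.Carrier :=
  Module.compHom M.Carrier M.act.toRingHom

instance (M : ModVariety rel d) : IsScalarTower k (BoundPathAlgebra rel) M.Carrier where
  smul_assoc c r m := by
    change M.act (c • r) m = c • M.act r m
    rw [map_smul, LinearMap.smul_apply]

instance (M : ModVariety rel d) : Module.Finite (BoundPathAlgebra rel) M.Carrier :=
  haveI : Module.Finite k M.Carrier := inferInstanceAs (Module.Finite k (∀ x : Δ, Fin (d x) → k))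
  Module.Finite.of_restrictScalars_finite k (BoundPathAlgebra rel) M.Carrier

/-- The point `M` of `mod_Λ^d(k)`, as an object of `mod Λ`. -/
noncomputable def toModule (M : ModVariety rel d) :
    FGModuleCat.{max u v} (BoundPathAlgebra rel) :=
  ⟨ModuleCat.of (BoundPathAlgebra rel) M.Carrier,
    inferInstanceAs (Module.Finite (BoundPathAlgebra rel) M.Carrier)⟩

end ModVariety

/-! ## Geometric bisections -/

variable [Fintype Δ] [DecidableEq Δ]

/-- The set `L(d)` of the points of `mod_Λ^d(k)` that belong to the full subcategory `L`
of `mod Λ`. -/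
def pointsOf (L : CategoryTheory.ObjectProperty (FGModuleCat.{max u v} (BoundPathAlgebra rel)))
    (d : Δ → ℕ) : Set (ModVariety rel d) :=
  {M | L M.toModule}

/-- The full subcategory `L` of `mod Λ` is closed under direct sums and direct summands. -/
structure ClosedUnderSumsAndSummands
    (L : CategoryTheory.ObjectProperty (FGModuleCat.{max u v} (BoundPathAlgebra rel))) : Prop where
  sum : ∀ M N P : FGModuleCat.{max u v} (BoundPathAlgebra rel),
    Nonempty (P ≃ₗ[BoundPathAlgebra rel] M × N) → L M → L N → L P
  summand : ∀ M N P : FGModuleCat.{max u v} (BoundPathAlgebra rel),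
    Nonempty (P ≃ₗ[BoundPathAlgebra rel] M × N) → L P → L M

/-- The pair `(L, R)` of full subcategories of `mod Λ` is a geometric bisection. -/
structure IsGeometricBisection
    (L R : CategoryTheory.ObjectProperty (FGModuleCat.{max u v} (BoundPathAlgebra rel))) :
    Prop where
  closed_left : ClosedUnderSumsAndSummands L
  closed_right : ClosedUnderSumsAndSummands R
  decomposition : ∀ M : FGModuleCat.{max u v} (BoundPathAlgebra rel),
    ∃ U V : FGModuleCat.{max u v} (BoundPathAlgebra rel),
      L U ∧ R V ∧ Nonempty (M ≃ₗ[BoundPathAlgebra rel] U × V)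
  pdim_left : ∀ U, L U → CategoryTheory.HasProjectiveDimensionLE U.obj 1
  idim_right : ∀ V, R V → CategoryTheory.HasInjectiveDimensionLE V.obj 1
  hom_eq_zero : ∀ U V, L U → R V → ∀ f : V →ₗ[BoundPathAlgebra rel] U, f = 0
  ext_eq_zero : ∀ U V, L U → R V → ∀ e : CategoryTheory.Abelian.Ext U.obj V.obj 1, e = 0
  isOpen_left : ∀ d : Δ → ℕ, IsOpen (pointsOf L d)
  isOpen_right : ∀ d : Δ → ℕ, IsOpen (pointsOf R d)
  irreducible_left : ∀ d : Δ → ℕ, (pointsOf L d).Nonempty → IsIrreducible (pointsOf L d)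
  irreducible_right : ∀ d : Δ → ℕ, (pointsOf R d).Nonempty → IsIrreducible (pointsOf R d)

/-- The pair `(L, R)` is determined by the modules `H x`, `x : X`: for each dimension vector
`d`, `L(d)` is the union of the sets `{M | Hom(H x, M) = 0}`, and `R(d)` is the intersection of
the sets `{M | Ext¹(H x, M) = 0}`. -/
structure IsDeterminedBy
    (L R : CategoryTheory.ObjectProperty (FGModuleCat.{max u v} (BoundPathAlgebra rel)))
    {X : Type*} (H : X → FGModuleCat.{max u v} (BoundPathAlgebra rel)) : Prop where
  left : ∀ d : Δ → ℕ, pointsOf L d =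
    ⋃ x : X, {M | ∀ f : H x →ₗ[BoundPathAlgebra rel] M.toModule, f = 0}
  right : ∀ d : Δ → ℕ, pointsOf R d =
    ⋂ x : X, {M | ∀ e : CategoryTheory.Abelian.Ext (H x).obj M.toModule.obj 1, e = 0}

end ModuleVariety

-- The proof is an induction on `dim End(N)`. Axiom 2 splits a point `N` of the closure of `L(d)` as
-- `u ⊕ v` with `u` in `L` and `v` in `R`. If `v = 0`, then `N` lies in `L(d)` and `M = N` works.
-- Otherwise the closure of `L(d)` contains a nonsplit extension `N₁` of `v` by `u`
-- (`exists_nonsplit_extension_inClosure`). Nonsplitness forces `dim End(N₁) < dim End(N)`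
-- (`finrank_end_lt`), so `N₁` lies in the closure of some orbit `O_M` with `M` in `L(d)`. An
-- extension degenerates to the direct sum of its ends (`mem_closure_orbit_of_extension`), hence `N`
-- lies there too.
--
-- The extension arises as a limit. Since `L(d)` is irreducible, the coordinate ring of its closure
-- is a domain, over which there is a tautological representation. Write it in blocks adapted to `N
-- = u ⊕ v` and conjugate by a unipotent `1 - ihq`. At `h = 0` the derivative of the upper right
-- block in `h` is the coboundary `h ↦ uh - hv`, which is injective because `Hom(v, u) = 0`. After
-- an étale extension of the base that is still a domain, `h` can therefore be chosen so that the
-- upper right block `z` lies in a fixed complement of the coboundaries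
-- (`exists_normalized_family`).
--
-- If `z = 0`, the generic member of the family has a subrepresentation close to `v`. By openness of
-- `L` and `R`, some module in `L` then has a nonzero submodule in `R`, against `Hom(R, L) = 0`. If
-- `z ≠ 0`, a further extension of the base lets one entry `t` of `z` divide all the others
-- (`exists_affine_domain_divides`). Rescaling one summand by `t` replaces `z` by `z / t` and the
-- lower left block by its product with `t`, without changing isomorphism classes where `t ≠ 0`.
-- Over the point `N` the diagonal blocks become `u` and `v`, the lower left block becomes `0`, and
-- the upper right block is a nonzero element of the complement, so it is not a coboundary.

universe w

/-! ## Points of finitely generated algebras -/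

section Points

variable {k : Type*} [Field k] [IsAlgClosed k]

/-- Nullstellensatz: the residue field at a maximal ideal is finite over `k`, hence equal to `k`. -/
theorem exists_algHom_of_finiteType (A : Type*) [CommRing A] [Algebra k A] [Nontrivial A]
    [Algebra.FiniteType k A] : Nonempty (A →ₐ[k] k) := by
  obtain ⟨m, hm⟩ := Ideal.exists_maximal A
  let _ := Ideal.Quotient.field m
  have : Module.Finite k (A ⧸ m) := finite_of_finite_type_of_isJacobsonRing k (A ⧸ m)
  have hb : Function.Bijective (algebraMap k (A ⧸ m)) :=
    IsAlgClosed.algebraMap_bijective_of_isIntegral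
  exact ⟨(AlgEquiv.ofBijective (Algebra.ofId k (A ⧸ m)) hb).symm.toAlgHom.comp
    (Ideal.Quotient.mkₐ k m)⟩

/-- A point of the localization `A[1/x]` is a point of `A` at which `x` is invertible. This is how
generic statements over `A` are tested at `k`-points. -/
theorem exists_algHom_apply_ne_zero {A : Type*} [CommRing A] [Algebra k A] [IsDomain A]
    [Algebra.FiniteType k A] {x : A} (hx : x ≠ 0) : ∃ θ : A →ₐ[k] k, θ x ≠ 0 := by
  have : Nontrivial (Localization.Away x) :=
    (IsLocalization.injective (Localization.Away x)
      (powers_le_nonZeroDivisors_of_noZeroDivisors hx)).nontrivial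
  have : Algebra.FiniteType A (Localization.Away x) := IsLocalization.finiteType_of_monoid_fg
    (Submonoid.powers x) _
  have : Algebra.FiniteType k (Localization.Away x) := Algebra.FiniteType.trans (S := A) ‹_› ‹_›
  obtain ⟨θ⟩ := exists_algHom_of_finiteType (k := k) (Localization.Away x)
  refine ⟨θ.comp (IsScalarTower.toAlgHom k A (Localization.Away x)), ?_⟩
  exact ((IsLocalization.Away.algebraMap_isUnit (S := Localization.Away x) x).map θ).ne_zero

end Points

/-! ## Étale neighbourhoods -/

section Etale

open MvPolynomial

/-- With as many equations as variables, an invertible Jacobian makes the naive presentation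
submersive. Smoothness will be used only to go down along primes. -/
theorem smooth_quotient_of_isUnit_jacobian {B : Type*} [CommRing B] {τ : Type*} [Fintype τ]
    [DecidableEq τ] (v : τ → MvPolynomial τ B)
    (hJ : IsUnit (Ideal.Quotient.mk (Ideal.span (Set.range v))
      (Matrix.of fun i j => pderiv i (v j)).det)) :
    Algebra.Smooth B (MvPolynomial τ B ⧸ Ideal.span (Set.range v)) := by
  let P := Algebra.PreSubmersivePresentation.naive (v := v) (fun i => i) Function.injective_id
  have hP : IsUnit P.jacobian := by
    rw [Algebra.PreSubmersivePresentation.jacobian_eq_jacobiMatrix_det]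
    have : P.jacobiMatrix = Matrix.of fun i j => pderiv i (v j) := by
      refine Matrix.ext fun i j => ?_
      exact Algebra.PreSubmersivePresentation.jacobiMatrix_naive (v := v) (fun i => i)
        Function.injective_id _ (Function.surjInv_eq Ideal.Quotient.mk_surjective) i j
    rw [this]
    exact hJ
  let Q : Algebra.SubmersivePresentation B (MvPolynomial τ B ⧸ Ideal.span (Set.range v)) τ τ :=
    { P with jacobian_isUnit := hP }
  have := Q.isStandardSmooth
  infer_instance

/-- A square system of equations over a domain `B` with invertible Jacobian at a point has a
solution in a domain extending `B`, through the given point. -/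
theorem exists_domain_solution {k : Type*} [Field k] {B : Type*} [CommRing B] [IsDomain B]
    [Algebra k B] (ψ : B →ₐ[k] k) {τ : Type*} [Fintype τ] [DecidableEq τ]
    (F : τ → MvPolynomial τ B)
    (h₀ : ∀ i, eval₂Hom (ψ : B →+* k) (0 : τ → k) (F i) = 0)
    (hJ : ∀ i j, eval₂Hom (ψ : B →+* k) (0 : τ → k) (pderiv i (F j)) = if i = j then 1 else 0) :
    ∃ I : Ideal (MvPolynomial (τ ⊕ Unit) B), I.IsPrime ∧
      (∀ b : B, C b ∈ I → b = 0) ∧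
      (∀ i, rename Sum.inl (F i) ∈ I) ∧
      ∃ φ : (MvPolynomial (τ ⊕ Unit) B ⧸ I) →ₐ[k] k,
        (∀ b : B, φ (Ideal.Quotient.mk I (C b)) = ψ b) ∧
        ∀ i, φ (Ideal.Quotient.mk I (X (Sum.inl i))) = 0 := by
  classical
  let _ : Algebra B k := (ψ : B →+* k).toAlgebra
  have : IsScalarTower k B k := IsScalarTower.of_algebraMap_eq fun c => (ψ.commutes c).symm
  change ∀ i, aeval (0 : τ → k) (F i) = 0 at h₀
  change ∀ i j, aeval (0 : τ → k) (pderiv i (F j)) = if i = j then 1 else 0 at hJ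
  let J : MvPolynomial τ B := (Matrix.of fun i j => pderiv i (F j)).det
  have hJ1 : aeval (0 : τ → k) J = 1 := by
    have : (aeval (0 : τ → k)).toRingHom.mapMatrix
        (Matrix.of fun i j => pderiv i (F j)) = 1 := by
      ext i j
      simpa [Matrix.one_apply] using hJ i j
    have h2 := RingHom.map_det (aeval (R := B) (0 : τ → k)).toRingHom
      (Matrix.of fun i j => pderiv i (F j))
    rw [this, Matrix.det_one] at h2
    exact h2
  -- The extra variable is an inverse of the Jacobian `J`, which is invertible only near the given
  -- point.
  let v : τ ⊕ Unit → MvPolynomial (τ ⊕ Unit) B :=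
    Sum.elim (fun i => rename Sum.inl (F i)) fun _ => X (Sum.inr ()) * rename Sum.inl J - 1
  have hpd : ∀ f : MvPolynomial τ B, pderiv (Sum.inr ()) (rename (Sum.inl : τ → τ ⊕ Unit) f) = 0 :=
    fun f => by
    apply pderiv_eq_zero_of_notMem_vars
    intro hmem
    have := vars_rename Sum.inl f hmem
    simp at this
  let T := MvPolynomial (τ ⊕ Unit) B ⧸ Ideal.span (Set.range v)
  -- The enlarged Jacobian matrix is block triangular: the old block has determinant `J`, and the
  -- derivative of the new equation in the new variable is again `J`.
  have hdet : (Matrix.of fun i j => pderiv i (v j)).det = rename Sum.inl (J * J) := by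
    have : (Matrix.of fun i j => pderiv i (v j)) = Matrix.fromBlocks
        ((Matrix.of fun i j => pderiv i (F j)).map (rename Sum.inl))
        (Matrix.of fun i (_ : Unit) => pderiv (Sum.inl i) (v (Sum.inr ()))) 0
        (Matrix.of fun (_ _ : Unit) => rename Sum.inl J) := by
      ext i j : 2
      rcases i with i | i <;> rcases j with j | j
      · simp [v, pderiv_rename Sum.inl_injective]
      · simp
      · simp [v, hpd]
      · simp [v, hpd]
    rw [this, Matrix.det_fromBlocks_zero₂₁, map_mul]
    congr 1
    · exact (AlgHom.map_det (rename (Sum.inl : τ → τ ⊕ Unit)) _).symm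
    · simp
  have hunit : IsUnit (Ideal.Quotient.mk (Ideal.span (Set.range v)) (rename Sum.inl J)) := by
    refine .of_mul_eq_one (Ideal.Quotient.mk _ (X (Sum.inr ()))) ?_
    rw [← map_mul, mul_comm, ← sub_eq_zero, ← map_one (Ideal.Quotient.mk _), ← map_sub,
      Ideal.Quotient.eq_zero_iff_mem]
    exact Ideal.subset_span ⟨Sum.inr (), rfl⟩
  have : Algebra.Smooth B T := smooth_quotient_of_isUnit_jacobian v (by
    rw [hdet, map_mul, map_mul]
    exact hunit.mul hunit)
  -- the given point
  let pt : MvPolynomial (τ ⊕ Unit) B →ₐ[B] k := aeval (Sum.elim 0 fun _ => 1)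
  have hpt : ∀ f : MvPolynomial τ B, pt (rename Sum.inl f) = aeval (0 : τ → k) f := fun f => by
    simp [pt, aeval_rename]
  have hspan : ∀ a ∈ Ideal.span (Set.range v), pt a = 0 := by
    have : Ideal.span (Set.range v) ≤ RingHom.ker pt := by
      rw [Ideal.span_le]
      rintro _ ⟨i | i, rfl⟩
      · change pt (rename Sum.inl (F i)) = 0
        rw [hpt, h₀]
      · change pt (X (Sum.inr ()) * rename Sum.inl J - 1) = 0
        rw [map_sub, map_mul, hpt, hJ1]
        simp [pt]
    exact fun a ha => this ha
  let ptT : T →ₐ[B] k := Ideal.Quotient.liftₐ _ pt hspan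
  let Q : Ideal T := RingHom.ker ptT
  have : Q.IsPrime := RingHom.ker_isPrime _
  have : Q.LiesOver (Q.under B) := ⟨rfl⟩
  -- `T` itself need not be a domain. Going down from the given point `Q` yields a prime `P` inside
  -- `Q` over `0`: the quotient by `P` is a domain containing `B`, and the point factors through it.
  obtain ⟨P, hPQ, hP, hPB⟩ := Ideal.exists_ideal_le_liesOver_of_le (R := B) (p := ⊥)
    (q := Q.under B) Q bot_le
  refine ⟨P.comap (Ideal.Quotient.mk _), inferInstance, ?_, ?_, ?_⟩
  · intro b hb
    have : b ∈ P.under B := hb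
    rw [← hPB.over] at this
    exact this
  · intro i
    have : Ideal.Quotient.mk (Ideal.span (Set.range v)) (rename Sum.inl (F i)) = 0 :=
      Ideal.Quotient.eq_zero_iff_mem.2 (Ideal.subset_span ⟨Sum.inl i, rfl⟩)
    rw [Ideal.mem_comap, this]
    exact P.zero_mem
  · refine ⟨Ideal.Quotient.liftₐ _ (pt.restrictScalars k) ?_, ?_, ?_⟩
    · intro a ha
      exact hPQ ha
    · intro b
      exact pt.commutes b
    · intro i
      change pt (X (Sum.inl i)) = 0
      simp [pt]

end Etale

/-! ## Dividing by a coordinate of maximal value -/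

section Blowup

/-- Among finitely many elements one has maximal value, and it divides the others in the valuation
ring. -/
theorem exists_dominant_coordinate {K : Type*} [Field K] (O : ValuationSubring K) {S : Type*}
    [Finite S] (z : S → K) (hz : z ≠ 0) :
    ∃ s₀, z s₀ ≠ 0 ∧ ∀ s, z s / z s₀ ∈ O := by
  obtain ⟨s₁, hs₁⟩ := Function.ne_iff.1 hz
  have : Nonempty S := ⟨s₁⟩
  obtain ⟨s₀, hs₀⟩ := Finite.exists_max fun s => O.valuation (z s)
  have h0 : z s₀ ≠ 0 := by
    intro h
    have := hs₀ s₁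
    rw [h, map_zero, le_zero_iff, map_eq_zero] at this
    exact hs₁ this
  refine ⟨s₀, h0, fun s => ?_⟩
  rw [← O.valuation_le_one_iff, map_div₀]
  exact div_le_one_of_le₀ (hs₀ s) zero_le

/-- Some coordinate `z s₀` generates the ideal of all the `z s` in an affine domain containing
the given one and having a point over the given point. -/
theorem exists_affine_domain_divides {k : Type*} [Field k] [IsAlgClosed k] {C : Type w} [CommRing C]
    [IsDomain C] [Algebra k C] [Algebra.FiniteType k C] (φ : C →ₐ[k] k) {S : Type*} [Finite S]
    (z : S → C) (hz : z ≠ 0) :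
    ∃ (A : Type w) (_ : CommRing A) (_ : IsDomain A) (_ : Algebra k A) (ι : C →ₐ[k] A) (s₀ : S)
      (w : S → A) (θ : A →ₐ[k] k), Algebra.FiniteType k A ∧ ι (z s₀) ≠ 0 ∧ w s₀ = 1 ∧
      (∀ s, ι (z s) = ι (z s₀) * w s) ∧ ∀ c, θ (ι c) = φ c := by
  classical
  let K := FractionRing C
  have hinj : Function.Injective (algebraMap C K) := IsFractionRing.injective C K
  let e : C ≃+* (algebraMap C K).range := RingEquiv.ofBijective (algebraMap C K).rangeRestrict
    ⟨fun a b h => hinj (congrArg Subtype.val h), (algebraMap C K).rangeRestrict_surjective⟩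
  have hprop : (RingHom.ker (φ : C →+* k)).map e ≠ ⊤ := by
    intro h
    have h1 := congrArg (Ideal.comap e) h
    rw [Ideal.comap_map_of_bijective _ e.bijective, Ideal.comap_top] at h1
    exact RingHom.ker_ne_top _ h1
  -- `O` is a valuation ring of the fraction field that contains `C` and has the maximal ideal of
  -- the point `φ` among its nonunits.
  obtain ⟨O, hO, hm⟩ := Ideal.image_subset_nonunits_valuationSubring _ hprop
  have hO' : ∀ c, algebraMap C K c ∈ O := fun c => hO ⟨c, rfl⟩
  have hm' : ∀ c, φ c = 0 → algebraMap C K c ∈ O.nonunits := fun c hc =>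
    hm ⟨e c, Ideal.mem_map_of_mem _ hc, rfl⟩
  obtain ⟨s₀, hs₀, hdiv⟩ := exists_dominant_coordinate O (fun s => algebraMap C K (z s)) (by
    intro h
    exact hz (funext fun s => hinj (by simpa using congrFun h s)))
  -- An affine chart of the blowup of the ideal of the `z s`. The valuation ring serves only to
  -- choose a chart that has a point over `φ`.
  let A : Subalgebra C K :=
    Algebra.adjoin C (Set.range fun s => algebraMap C K (z s) / algebraMap C K (z s₀))
  have hAO : ∀ x ∈ A, x ∈ O := by
    intro x hx
    refine Algebra.adjoin_induction ?_ hO' (fun _ _ _ _ => add_mem) (fun _ _ _ _ => mul_mem) hx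
    rintro _ ⟨s, rfl⟩
    exact hdiv s
  have : Algebra.FiniteType C A := by
    rw [← Subalgebra.fg_iff_finiteType]
    exact Subalgebra.fg_def.2 ⟨_, Set.finite_range _, rfl⟩
  have : Algebra.FiniteType k A := Algebra.FiniteType.trans (S := C) ‹_› ‹_›
  let I : Ideal A := (RingHom.ker (φ : C →+* k)).map (algebraMap C A)
  -- The fibre over `φ` is nonempty: its ideal lies in the contraction to `A` of the maximal ideal
  -- of `O`.
  have hI : I ≠ ⊤ := by
    intro h
    let ι : A →+* O := A.val.toRingHom.codRestrict O.toSubring fun x => hAO x x.2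
    have hle : I ≤ (IsLocalRing.maximalIdeal O).comap ι := by
      rw [Ideal.map_le_iff_le_comap]
      intro c hc
      have h2 := hm' c hc
      rw [← SetLike.mem_coe, ← O.image_maximalIdeal] at h2
      obtain ⟨y, hy, hyc⟩ := h2
      have : ι (algebraMap C A c) = y := Subtype.ext hyc.symm
      change ι (algebraMap C A c) ∈ IsLocalRing.maximalIdeal O
      rw [this]
      exact hy
    rw [h, top_le_iff] at hle
    exact Ideal.IsPrime.ne_top inferInstance hle
  have : Nontrivial (A ⧸ I) := Ideal.Quotient.nontrivial_iff.2 hI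
  have : Algebra.FiniteType k (A ⧸ I) :=
    Algebra.FiniteType.of_surjective (Ideal.Quotient.mkₐ k I) Ideal.Quotient.mk_surjective
  obtain ⟨θ⟩ := exists_algHom_of_finiteType (k := k) (A ⧸ I)
  refine ⟨A, inferInstance, inferInstance, inferInstance, IsScalarTower.toAlgHom k C A, s₀, fun s => ⟨_, Algebra.subset_adjoin ⟨s, rfl⟩⟩,
    θ.comp (Ideal.Quotient.mkₐ k I),
    ‹_›, ?_, ?_, ?_, ?_⟩
  · intro h
    exact hs₀ (congrArg Subtype.val h)
  · exact Subtype.ext (div_self hs₀)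
  · intro s
    refine Subtype.ext ?_
    exact (mul_div_cancel₀ _ hs₀).symm
  · intro c
    -- A homomorphism on `A / I` kills `ker φ`, so on `C = k + ker φ` it must agree with `φ`.
    have h1 : c - algebraMap k C (φ c) ∈ RingHom.ker (φ : C →+* k) := by
      rw [RingHom.mem_ker, map_sub]
      simp
    have h2 : algebraMap C A (c - algebraMap k C (φ c)) ∈ I := Ideal.mem_map_of_mem _ h1
    rw [map_sub, ← IsScalarTower.algebraMap_apply k C A] at h2
    have h3 := Ideal.Quotient.eq.2 h2
    change θ (Ideal.Quotient.mk I (algebraMap C A c)) = φ c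
    rw [h3]
    exact θ.commutes (φ c)

end Blowup

/-! ## Families of matrices indexed by arrows and vertices -/

section Families

variable {Δ : Type v} [Quiver.{v} Δ]

/-- Families of matrices indexed by the arrows; for `d = d'` these are the representations over the
ring `A`. -/
abbrev ArrowMatrices (A : Type*) (d d' : Δ → ℕ) :=
  ∀ a b : Δ, (a ⟶ b) → Matrix (Fin (d' b)) (Fin (d a)) A

/-- Families of matrices indexed by the vertices. -/
abbrev VertexMatrices (A : Type*) (d d' : Δ → ℕ) :=
  ∀ x : Δ, Matrix (Fin (d' x)) (Fin (d x)) A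

/-- The set of the entries of a family indexed by the arrows. -/
abbrev ArrowIndex (d d' : Δ → ℕ) := Σ a b : Δ, (a ⟶ b) × Fin (d' b) × Fin (d a)

/-- The set of the entries of a family indexed by the vertices. -/
abbrev VertexIndex (d d' : Δ → ℕ) := Σ x : Δ, Fin (d' x) × Fin (d x)

namespace ArrowMatrices

variable {A A' : Type*} {d d' : Δ → ℕ}

/-- The entries of a family, as one vector. -/
def entries (M : ArrowMatrices A d d') : ArrowIndex d d' → A :=
  fun s => M s.1 s.2.1 s.2.2.1 s.2.2.2.1 s.2.2.2.2

/-- The family with given entries. -/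
def ofEntries (m : ArrowIndex d d' → A) : ArrowMatrices A d d' :=
  fun a b α => Matrix.of fun r s => m ⟨a, b, α, r, s⟩

/-- Apply a map to all the entries. -/
def map (M : ArrowMatrices A d d') (f : A → A') : ArrowMatrices A' d d' :=
  fun a b α => (M a b α).map f

@[simp] theorem map_apply (M : ArrowMatrices A d d') (f : A → A') {a b : Δ} (α : a ⟶ b) :
    M.map f a b α = (M a b α).map f := rfl

@[simp] theorem ofEntries_entries (M : ArrowMatrices A d d') : ofEntries M.entries = M := rfl

theorem entries_map (M : ArrowMatrices A d d') (f : A → A') (s : ArrowIndex d d') :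
    (M.map f).entries s = f (M.entries s) := rfl

theorem entries_injective :
    Function.Injective (entries : ArrowMatrices A d d' → ArrowIndex d d' → A) :=
  Function.LeftInverse.injective (g := ofEntries) ofEntries_entries

theorem map_map {A'' : Type*} (M : ArrowMatrices A d d') (f : A → A') (g : A' → A'') :
    (M.map f).map g = M.map (g ∘ f) := rfl

end ArrowMatrices

namespace VertexMatrices

variable {A A' : Type*} {d d' : Δ → ℕ}

/-- The family with given entries. -/
def ofEntries (m : VertexIndex d d' → A) : VertexMatrices A d d' :=
  fun x => Matrix.of fun r s => m ⟨x, r, s⟩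

/-- Apply a map to all the entries. -/
def map (M : VertexMatrices A d d') (f : A → A') : VertexMatrices A' d d' :=
  fun x => (M x).map f

@[simp] theorem map_apply (M : VertexMatrices A d d') (f : A → A') (x : Δ) :
    M.map f x = (M x).map f := rfl

theorem map_map {A'' : Type*} (M : VertexMatrices A d d') (f : A → A') (g : A' → A'') :
    (M.map f).map g = M.map (g ∘ f) := rfl

theorem ofEntries_map (m : VertexIndex d d' → A) (f : A → A') :
    (ofEntries m).map f = ofEntries (f ∘ m) := rfl

end VertexMatrices

/-- `f` is a morphism from the representation `M` to the representation `N`. -/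
def Intertwines {A : Type*} [CommRing A] {d d' : Δ → ℕ} (f : VertexMatrices A d d')
    (M : ArrowMatrices A d d) (N : ArrowMatrices A d' d') : Prop :=
  ∀ (a b : Δ) (α : a ⟶ b), N a b α * f a = f b * M a b α

/-- A decomposition `A^d = A^d' ⊕ A^d''` at each vertex. -/
structure Splitting (A : Type*) [CommRing A] (d d' d'' : Δ → ℕ) where
  i : VertexMatrices A d' d
  j : VertexMatrices A d'' d
  p : VertexMatrices A d d'
  q : VertexMatrices A d d''
  p_i : ∀ x, p x * i x = 1
  q_j : ∀ x, q x * j x = 1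
  p_j : ∀ x, p x * j x = 0
  q_i : ∀ x, q x * i x = 0
  add : ∀ x, i x * p x + j x * q x = 1

namespace Splitting

variable {A : Type*} [CommRing A] {A' : Type*} [CommRing A'] {d d' d'' : Δ → ℕ}
  (S : Splitting A d d' d'')

section Reassoc

variable (x : Δ) {m : Type*}

theorem p_i_assoc (X : Matrix (Fin (d' x)) m A) : S.p x * (S.i x * X) = X := by
  rw [← Matrix.mul_assoc, S.p_i, Matrix.one_mul]

theorem q_j_assoc (X : Matrix (Fin (d'' x)) m A) : S.q x * (S.j x * X) = X := by
  rw [← Matrix.mul_assoc, S.q_j, Matrix.one_mul]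

theorem p_j_assoc (X : Matrix (Fin (d'' x)) m A) : S.p x * (S.j x * X) = 0 := by
  rw [← Matrix.mul_assoc, S.p_j, Matrix.zero_mul]

theorem q_i_assoc (X : Matrix (Fin (d' x)) m A) : S.q x * (S.i x * X) = 0 := by
  rw [← Matrix.mul_assoc, S.q_i, Matrix.zero_mul]

end Reassoc

/-- Base change of a splitting. -/
def map (f : A →+* A') : Splitting A' d d' d'' where
  i := VertexMatrices.map S.i f
  j := VertexMatrices.map S.j f
  p := VertexMatrices.map S.p f
  q := VertexMatrices.map S.q f
  p_i x := by
    simp only [VertexMatrices.map_apply, ← Matrix.map_mul, S.p_i, Matrix.map_one _ f.map_zero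
      f.map_one]
  q_j x := by
    simp only [VertexMatrices.map_apply, ← Matrix.map_mul, S.q_j, Matrix.map_one _ f.map_zero
      f.map_one]
  p_j x := by
    simp only [VertexMatrices.map_apply, ← Matrix.map_mul, S.p_j, Matrix.map_zero _ f.map_zero]
  q_i x := by
    simp only [VertexMatrices.map_apply, ← Matrix.map_mul, S.q_i, Matrix.map_zero _ f.map_zero]
  add x := by
    simp only [VertexMatrices.map_apply, ← Matrix.map_mul, ← Matrix.map_add f f.map_add, S.add,
      Matrix.map_one _ f.map_zero f.map_one]

/-- The family with given blocks. -/
def assemble (u : ArrowMatrices A d' d') (z : ArrowMatrices A d'' d') (c : ArrowMatrices A d' d'')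
    (w : ArrowMatrices A d'' d'') : ArrowMatrices A d d := fun a b α =>
  S.i b * (u a b α * S.p a) + S.i b * (z a b α * S.q a) + S.j b * (c a b α * S.p a) +
    S.j b * (w a b α * S.q a)

/-- The upper left block of `(1 - ihq) M (1 + ihq)`. -/
def upperLeft (M : ArrowMatrices A d d) (h : VertexMatrices A d'' d') : ArrowMatrices A d' d' :=
  fun a b α => S.p b * (M a b α * S.i a) - h b * (S.q b * (M a b α * S.i a))

/-- The upper right block of `(1 - ihq) M (1 + ihq)`. -/
def upperRight (M : ArrowMatrices A d d) (h : VertexMatrices A d'' d') : ArrowMatrices A d'' d' :=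
  fun a b α => S.p b * (M a b α * S.j a) + S.p b * (M a b α * (S.i a * h a)) -
    h b * (S.q b * (M a b α * S.j a)) - h b * (S.q b * (M a b α * (S.i a * h a)))

/-- The lower left block of `M`. -/
def lowerLeft (M : ArrowMatrices A d d) : ArrowMatrices A d' d'' :=
  fun a b α => S.q b * (M a b α * S.i a)

/-- The lower right block of `(1 - ihq) M (1 + ihq)`. -/
def lowerRight (M : ArrowMatrices A d d) (h : VertexMatrices A d'' d') : ArrowMatrices A d'' d'' :=
  fun a b α => S.q b * (M a b α * S.j a) + S.q b * (M a b α * (S.i a * h a))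

section Map

variable (f : A →+* A')

theorem assemble_map (u : ArrowMatrices A d' d') (z : ArrowMatrices A d'' d')
    (c : ArrowMatrices A d' d'') (w : ArrowMatrices A d'' d'') :
    (S.assemble u z c w).map f = (S.map f).assemble (u.map f) (z.map f) (c.map f) (w.map f) := by
  funext a b α
  simp [assemble, map, Matrix.map_add f f.map_add]

theorem upperLeft_map (M : ArrowMatrices A d d) (h : VertexMatrices A d'' d') :
    (S.upperLeft M h).map f = (S.map f).upperLeft (M.map f) (h.map f) := by
  funext a b α
  simp [upperLeft, map, Matrix.map_sub f f.map_sub]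

theorem upperRight_map (M : ArrowMatrices A d d) (h : VertexMatrices A d'' d') :
    (S.upperRight M h).map f = (S.map f).upperRight (M.map f) (h.map f) := by
  funext a b α
  simp [upperRight, map, Matrix.map_sub f f.map_sub, Matrix.map_add f f.map_add]

theorem lowerLeft_map (M : ArrowMatrices A d d) :
    (S.lowerLeft M).map f = (S.map f).lowerLeft (M.map f) := by
  funext a b α
  simp [lowerLeft, map]

theorem lowerRight_map (M : ArrowMatrices A d d) (h : VertexMatrices A d'' d') :
    (S.lowerRight M h).map f = (S.map f).lowerRight (M.map f) (h.map f) := by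
  funext a b α
  simp [lowerRight, map, Matrix.map_add f f.map_add]

end Map

/-- If the upper right block of `(1 - ihq) M (1 + ihq)` vanishes, then `j + ih` is a
subrepresentation. -/
theorem intertwines_of_upperRight_eq_zero (M : ArrowMatrices A d d) (h : VertexMatrices A d'' d')
    (hz : S.upperRight M h = 0) :
    Intertwines (fun x => S.j x + S.i x * h x) (S.lowerRight M h) M := by
  intro a b α
  have h1 : S.p b * (M a b α * (S.j a + S.i a * h a)) = h b * S.lowerRight M h a b α := by
    have := congrFun (congrFun (congrFun hz a) b) α
    simp only [upperRight, Pi.zero_apply] at this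
    rw [← sub_eq_zero, ← this]
    simp only [lowerRight, Matrix.mul_add]
    abel
  have h2 : S.q b * (M a b α * (S.j a + S.i a * h a)) = S.lowerRight M h a b α := by
    simp only [lowerRight, Matrix.mul_add]
  calc M a b α * (S.j a + S.i a * h a)
      = (S.i b * S.p b + S.j b * S.q b) * (M a b α * (S.j a + S.i a * h a)) := by
        rw [S.add, Matrix.one_mul]
    _ = _ := by
        rw [Matrix.add_mul, Matrix.mul_assoc, h1, Matrix.mul_assoc, h2, Matrix.add_mul,
          Matrix.mul_assoc, add_comm]

/-- Scaling the off-diagonal blocks of `(1 - ihq) M (1 + ihq)` by `t⁻¹` and `t`. -/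
theorem intertwines_rescale (M : ArrowMatrices A d d) (h : VertexMatrices A d'' d') (t : A)
    (w : ArrowMatrices A d'' d') (hw : S.upperRight M h = t • w) :
    Intertwines (fun x => S.i x * S.p x - S.i x * (h x * S.q x) + t • (S.j x * S.q x)) M
      (S.assemble (S.upperLeft M h) w (t • S.lowerLeft M) (S.lowerRight M h)) := by
  intro a b α
  have hz := congrFun (congrFun (congrFun hw a) b) α
  have hM : M a b α = M a b α * (S.i a * S.p a + S.j a * S.q a) := by rw [S.add, Matrix.mul_one]
  calc _ = S.i b * (S.upperLeft M h a b α * S.p a) -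
        S.i b * (S.upperLeft M h a b α * (h a * S.q a)) + S.i b * ((t • w) a b α * S.q a) +
        t • (S.j b * (S.lowerLeft M a b α * S.p a)) -
        t • (S.j b * (S.lowerLeft M a b α * (h a * S.q a))) +
        t • (S.j b * (S.lowerRight M h a b α * S.q a)) := by
        simp only [assemble, Matrix.add_mul, Matrix.mul_add, Matrix.mul_sub, Matrix.mul_assoc,
          S.p_i_assoc, S.q_j_assoc, S.p_j_assoc, S.q_i_assoc, Matrix.mul_smul, Matrix.smul_mul,
          Matrix.mul_zero, Pi.smul_apply, smul_zero, smul_add]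
        abel
    _ = _ := by
        conv_rhs => rw [hM]
        rw [← hz]
        simp only [upperLeft, upperRight, lowerLeft, lowerRight, Matrix.add_mul, Matrix.mul_add,
          Matrix.mul_sub, Matrix.sub_mul, Matrix.mul_assoc, Matrix.smul_mul, smul_add]
        abel

/-- The factors are `(ip + t·jq)(1 - ihq)` and `(1 + ihq)(ip + s·jq)`. Thus the morphism of
`intertwines_rescale`, which exists for every `t`, is an isomorphism where `t` is invertible. -/
theorem rescale_mul (h : VertexMatrices A d'' d') (t s : A) (hts : t * s = 1) (x : Δ) :
    (S.i x * S.p x - S.i x * (h x * S.q x) + t • (S.j x * S.q x)) *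
      (S.i x * S.p x + s • (S.i x * (h x * S.q x)) + s • (S.j x * S.q x)) = 1 := by
  simp only [Matrix.add_mul, Matrix.mul_add, Matrix.sub_mul, Matrix.mul_assoc,
    S.p_i_assoc, S.q_j_assoc, S.p_j_assoc, S.q_i_assoc, Matrix.mul_smul, Matrix.smul_mul,
    Matrix.mul_zero, smul_zero, smul_add, smul_sub, smul_smul, (mul_comm s t).trans hts, one_smul,
    sub_zero, add_zero]
  rw [← S.add x]
  abel

section Blocks

variable (u : ArrowMatrices A d' d') (z : ArrowMatrices A d'' d') (c : ArrowMatrices A d' d'')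
  (w : ArrowMatrices A d'' d'') {a b : Δ} (α : a ⟶ b)

theorem p_assemble_i : S.p b * (S.assemble u z c w a b α * S.i a) = u a b α := by
  simp only [assemble, Matrix.add_mul, Matrix.mul_add, Matrix.mul_assoc, S.p_i, S.q_i,
    S.p_i_assoc, S.p_j_assoc, Matrix.mul_one, Matrix.mul_zero, add_zero]

theorem p_assemble_j : S.p b * (S.assemble u z c w a b α * S.j a) = z a b α := by
  simp only [assemble, Matrix.add_mul, Matrix.mul_add, Matrix.mul_assoc, S.p_j, S.q_j,
    S.p_i_assoc, S.p_j_assoc, Matrix.mul_one, Matrix.mul_zero, add_zero, zero_add]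

theorem q_assemble_i : S.q b * (S.assemble u z c w a b α * S.i a) = c a b α := by
  simp only [assemble, Matrix.add_mul, Matrix.mul_add, Matrix.mul_assoc, S.p_i, S.q_i,
    S.q_i_assoc, S.q_j_assoc, Matrix.mul_one, Matrix.mul_zero, add_zero, zero_add]

theorem q_assemble_j : S.q b * (S.assemble u z c w a b α * S.j a) = w a b α := by
  simp only [assemble, Matrix.add_mul, Matrix.mul_add, Matrix.mul_assoc, S.p_j, S.q_j,
    S.q_i_assoc, S.q_j_assoc, Matrix.mul_one, Matrix.mul_zero, zero_add]

end Blocks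

end Splitting

end Families

/-! ## Points of the closure over rings, and families through a decomposable point -/

section Closure

open MvPolynomial

variable {k : Type u} [Field k] {Δ : Type v} [Quiver.{v} Δ] {d d' d'' : Δ → ℕ}

/-- `M` is a point over `A` of the closure of the set `U` of representations over `k`. -/
def InClosure (U : Set (ArrowMatrices k d d)) {A : Type*} [CommRing A] [Algebra k A]
    (M : ArrowMatrices A d d) : Prop :=
  ∀ f : MvPolynomial (ArrowIndex d d) k, (∀ N ∈ U, aeval N.entries f = 0) → aeval M.entries f = 0

/-- `U` is stable under isomorphisms of representations. -/
def IsStable (U : Set (ArrowMatrices k d d)) : Prop :=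
  ∀ M N : ArrowMatrices k d d, ∀ g g' : VertexMatrices k d d, (∀ x, g x * g' x = 1) →
    Intertwines g M N → M ∈ U → N ∈ U

theorem ArrowMatrices.aeval_entries_map {A A' : Type*} [CommRing A] [Algebra k A] [CommRing A']
    [Algebra k A'] (M : ArrowMatrices A d d') (φ : A →ₐ[k] A')
    (f : MvPolynomial (ArrowIndex d d') k) :
    aeval (M.map φ).entries f = φ (aeval M.entries f) :=
  (MvPolynomial.comp_aeval_apply _ φ f).symm

theorem InClosure.map {U : Set (ArrowMatrices k d d)} {A A' : Type*} [CommRing A] [Algebra k A]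
    [CommRing A'] [Algebra k A'] {M : ArrowMatrices A d d} (hM : InClosure U M) (φ : A →ₐ[k] A') :
    InClosure U (M.map φ) := fun f hf => by
  rw [M.aeval_entries_map, hM f hf, map_zero]

theorem Intertwines.map {A A' : Type*} [CommRing A] [CommRing A'] {f : VertexMatrices A d d'}
    {M : ArrowMatrices A d d} {N : ArrowMatrices A d' d'} (hf : Intertwines f M N) (φ : A →+* A') :
    Intertwines (f.map φ) (M.map φ) (N.map φ) := fun a b α => by
  simp only [ArrowMatrices.map_apply, VertexMatrices.map_apply, ← Matrix.map_mul, hf a b α]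

theorem Intertwines.eq_mul {A : Type*} [CommRing A] {g g' : VertexMatrices A d d}
    (hg : ∀ x, g x * g' x = 1) {M N : ArrowMatrices A d d} (h : Intertwines g M N) :
    N = fun a b α => g b * M a b α * g' a := by
  funext a b α
  rw [← h a b α, Matrix.mul_assoc, hg, Matrix.mul_one]

/-- Conjugation by a fixed `g` is a polynomial map that preserves `U`. Hence a polynomial vanishing
on `U` still does so after substitution of the conjugated generic family `G`. -/
theorem IsStable.inClosure {U : Set (ArrowMatrices k d d)} (hU : IsStable U)
    {M N : ArrowMatrices k d d} {g g' : VertexMatrices k d d} (hg : ∀ x, g x * g' x = 1)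
    (h : Intertwines g M N) (hM : InClosure U M) : InClosure U N := by
  intro f hf
  let G : ArrowMatrices (MvPolynomial (ArrowIndex d d) k) d d := fun a b α =>
    (g b).map (C : k → MvPolynomial (ArrowIndex d d) k) *
      (ArrowMatrices.ofEntries X :
        ArrowMatrices (MvPolynomial (ArrowIndex d d) k) d d) a b α *
      (g' a).map (C : k → MvPolynomial (ArrowIndex d d) k)
  have hG : ∀ L : ArrowMatrices k d d,
      G.map (aeval (R := k) L.entries) = fun a b α => g b * L a b α * g' a := by
    intro L
    funext a b α
    simp only [G, ArrowMatrices.map_apply, Matrix.map_mul]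
    congr 1
    · congr 1
      · ext; simp
      · ext r s
        simp [ArrowMatrices.ofEntries, ArrowMatrices.entries]
    · ext; simp
  have key : ∀ L : ArrowMatrices k d d, aeval L.entries (aeval G.entries f) =
      aeval (ArrowMatrices.entries fun a b α => g b * L a b α * g' a) f := fun L => by
    rw [← hG, ArrowMatrices.aeval_entries_map]
  rw [h.eq_mul hg, ← key]
  refine hM _ fun L hL => ?_
  rw [key]
  refine hf _ (hU L _ g g' hg (fun a b α => ?_) hL)
  rw [Matrix.mul_assoc, mul_eq_one_comm.1 (hg a), Matrix.mul_one]

/-- The closure of a stable set is stable under isomorphisms over the complement of `t = 0`. -/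
theorem IsStable.inClosure_of_generic [IsAlgClosed k] {U : Set (ArrowMatrices k d d)}
    (hU : IsStable U) {A : Type*} [CommRing A] [Algebra k A] [IsDomain A] [Algebra.FiniteType k A]
    {t : A} (ht : t ≠ 0) {M N : ArrowMatrices A d d} (hM : InClosure U M)
    (h : ∀ θ : A →ₐ[k] k, θ t ≠ 0 → ∃ g g' : VertexMatrices k d d, (∀ x, g x * g' x = 1) ∧
      Intertwines g (M.map θ) (N.map θ)) : InClosure U N := by
  intro f hf
  by_contra hne
  -- In the domain `A` the product of `t` with the value of `f` at `N` is nonzero, so some `k`-point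
  -- avoids both zero sets; there `N` is isomorphic to a point of the closure.
  obtain ⟨θ, hθ⟩ := exists_algHom_apply_ne_zero (k := k) (mul_ne_zero ht hne)
  rw [map_mul] at hθ
  obtain ⟨g, g', hg, hgi⟩ := h θ (left_ne_zero_of_mul hθ)
  refine right_ne_zero_of_mul hθ ?_
  rw [← N.aeval_entries_map]
  exact hU.inClosure hg hgi (hM.map θ) f hf

/-- The coboundary `h ↦ u h - h v`. -/
def coboundary (u : ArrowMatrices k d' d') (v : ArrowMatrices k d'' d'') :
    VertexMatrices k d'' d' →ₗ[k] ArrowMatrices k d'' d' where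
  toFun h a b α := u a b α * h a - h b * v a b α
  map_add' h h' := by
    funext a b α
    simp only [Pi.add_apply, Matrix.mul_add, Matrix.add_mul]
    abel
  map_smul' c h := by
    funext a b α
    simp [smul_sub]

theorem coboundary_apply (u : ArrowMatrices k d' d') (v : ArrowMatrices k d'' d'')
    (h : VertexMatrices k d'' d') {a b : Δ} (α : a ⟶ b) :
    coboundary u v h a b α = u a b α * h a - h b * v a b α := rfl

/-- The kernel of the coboundary is `Hom(v, u)`. `P` is the matrix of a left inverse, and `ker P` is
the complement of the coboundaries used for normalization. -/
theorem exists_coboundary_retraction [Fintype Δ] [∀ a b : Δ, Fintype (a ⟶ b)]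
    (u : ArrowMatrices k d' d') (v : ArrowMatrices k d'' d'')
    (hinj : ∀ h : VertexMatrices k d'' d', Intertwines h v u → h = 0) :
    ∃ P : VertexIndex d'' d' → ArrowIndex d'' d' → k, ∀ (x : VertexIndex d'' d' → k) t,
      ∑ s, P t s * (coboundary u v (VertexMatrices.ofEntries x)).entries s = x t := by
  classical
  let D : (VertexIndex d'' d' → k) →ₗ[k] (ArrowIndex d'' d' → k) :=
    { toFun x := (coboundary u v (VertexMatrices.ofEntries x)).entries
      map_add' x y := congrArg ArrowMatrices.entries
        ((coboundary u v).map_add (VertexMatrices.ofEntries x) (VertexMatrices.ofEntries y))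
      map_smul' c x := congrArg ArrowMatrices.entries
        ((coboundary u v).map_smul c (VertexMatrices.ofEntries x)) }
  obtain ⟨P, hP⟩ := LinearMap.exists_leftInverse_of_injective D (by
    rw [LinearMap.ker_eq_bot']
    intro x hx
    have h0 : VertexMatrices.ofEntries x = 0 := by
      refine hinj _ fun a b α => ?_
      have h1 : coboundary u v (VertexMatrices.ofEntries x) = 0 :=
        ArrowMatrices.entries_injective hx
      exact sub_eq_zero.1 (congrFun (congrFun (congrFun h1 a) b) α)
    funext t
    exact congrFun (congrFun (congrFun h0 t.1) t.2.1) t.2.2)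
  refine ⟨fun t s => P (Pi.single s 1) t, fun x t => ?_⟩
  have h1 : P (D x) t = x t := congrFun (LinearMap.congr_fun hP x) t
  rw [← h1, LinearMap.pi_apply_eq_sum_univ P (D x), Finset.sum_apply]
  refine Finset.sum_congr rfl fun s _ => ?_
  have h2 : (Pi.single s 1 : ArrowIndex d'' d' → k) = fun s' => if s = s' then 1 else 0 := by
    funext s'
    simp [Pi.single_apply, eq_comm]
  rw [Pi.smul_apply, smul_eq_mul, mul_comm, ← h2]
  rfl

theorem Matrix.map_derivation_mul {R A : Type*} [CommRing R] [CommRing A] [Algebra R A]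
    (δ : Derivation R A A) {l m n : Type*} [Fintype m] (X : Matrix l m A) (Y : Matrix m n A) :
    (X * Y).map δ = X.map δ * Y + X * Y.map δ := by
  ext r s
  simp only [Matrix.map_apply, Matrix.mul_apply, map_sum, Derivation.leibniz, smul_eq_mul,
    Matrix.add_apply, ← Finset.sum_add_distrib]
  exact Finset.sum_congr rfl fun _ _ => by ring

/-- The linear part, at `h = 0`, of the upper right block of `(1 - ihq) M (1 + ihq)`. -/
theorem Splitting.pderiv_upperRight_map {B : Type*} [CommRing B] [Algebra k B]
    (S : Splitting k d d' d'') (M : ArrowMatrices B d d) (u : ArrowMatrices k d' d')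
    (v : ArrowMatrices k d'' d'') (ψ : B →ₐ[k] k) (hM : M.map ψ = S.assemble u 0 0 v)
    (t : VertexIndex d'' d') (ev : MvPolynomial (VertexIndex d'' d') B →+* k)
    (hevC : ∀ b, ev (C b) = ψ b) (hevX : ∀ t, ev (X t) = 0) [DecidableEq (VertexIndex d'' d')] :
    (((S.map (algebraMap k (MvPolynomial (VertexIndex d'' d') B))).upperRight (M.map C)
      (VertexMatrices.ofEntries X)).map (pderiv t)).map ev =
      coboundary u v (VertexMatrices.ofEntries (Pi.single t 1)) := by
  let T := S.map (algebraMap k (MvPolynomial (VertexIndex d'' d') B))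
  have hconst : ∀ {m n : Type} (Y : Matrix m n k),
      (Y.map (algebraMap k (MvPolynomial (VertexIndex d'' d') B))).map (pderiv t) = 0 := by
    intro m n Y
    ext r s : 2
    rw [Matrix.map_apply, Matrix.map_apply, IsScalarTower.algebraMap_apply k B, algebraMap_eq,
      pderiv_C, Matrix.zero_apply]
  have hconst' : ∀ {m n : Type} (Y : Matrix m n B),
      (Y.map (C : B →+* MvPolynomial (VertexIndex d'' d') B)).map (pderiv t) = 0 := by
    intro m n Y
    ext r s : 2
    rw [Matrix.map_apply, Matrix.map_apply, pderiv_C, Matrix.zero_apply]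
  have hevk : ∀ c, ev (algebraMap k _ c) = c := fun c => by
    rw [IsScalarTower.algebraMap_apply k B, algebraMap_eq, hevC, AlgHom.commutes]
    rfl
  have hev : ∀ {m n : Type} (Y : Matrix m n k),
      (Y.map (algebraMap k (MvPolynomial (VertexIndex d'' d') B))).map ev = Y := by
    intro m n Y
    ext r s
    exact hevk _
  have hX : ∀ x, ((VertexMatrices.ofEntries X : VertexMatrices
      (MvPolynomial (VertexIndex d'' d') B) d'' d') x).map ev = 0 := by
    intro x
    ext r s
    simp [VertexMatrices.ofEntries, hevX]
  have hdX : ∀ x, (((VertexMatrices.ofEntries X : VertexMatrices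
      (MvPolynomial (VertexIndex d'' d') B) d'' d') x).map (pderiv t)).map ev =
      (VertexMatrices.ofEntries (Pi.single t 1) : VertexMatrices k d'' d') x := by
    intro x
    ext r s
    simp only [VertexMatrices.ofEntries, Matrix.map_apply, Matrix.of_apply, pderiv_X,
      Pi.single_apply]
    split_ifs <;> simp
  have hMev : ∀ {a b : Δ} (α : a ⟶ b), ((M a b α).map C).map ev = S.assemble u 0 0 v a b α := by
    intro a b α
    rw [← hM]
    ext r s
    simp [hevC]
  funext a b α
  have h1 : ∀ {l m : Type} (Y Z : Matrix l m (MvPolynomial (VertexIndex d'' d') B)),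
      (Y - Z).map (pderiv t) = Y.map (pderiv t) - Z.map (pderiv t) :=
    fun Y Z => Matrix.map_sub _ (map_sub _) Y Z
  have h2 : ∀ {l m : Type} (Y Z : Matrix l m (MvPolynomial (VertexIndex d'' d') B)),
      (Y + Z).map (pderiv t) = Y.map (pderiv t) + Z.map (pderiv t) :=
    fun Y Z => Matrix.map_add _ (map_add _) Y Z
  -- Evaluation sets `h = 0` and `M = u ⊕ v`. The quadratic term drops out, and only `(pMi) dh - dh
  -- (qMj)` survives.
  simp only [ArrowMatrices.map_apply, Splitting.upperRight, Splitting.map,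
    VertexMatrices.map_apply, h1, h2, Matrix.map_derivation_mul, hconst, hconst', Matrix.zero_mul,
    Matrix.mul_zero, zero_add, add_zero, Matrix.map_sub ev ev.map_sub,
    Matrix.map_add ev ev.map_add, Matrix.map_mul, hev, hX, hdX, hMev, sub_zero]
  rw [← Matrix.mul_assoc (S.assemble u 0 0 v a b α), ← Matrix.mul_assoc, S.p_assemble_i,
    S.q_assemble_j, coboundary_apply]

theorem Splitting.upperRight_assemble_zero {A : Type*} [CommRing A] (S : Splitting A d d' d'')
    (u : ArrowMatrices A d' d') (v : ArrowMatrices A d'' d'') :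
    S.upperRight (S.assemble u 0 0 v) 0 = 0 := by
  funext a b α
  simp only [upperRight, S.p_assemble_j]
  simp

/-- Over an affine domain dominating the closure of `U` near `N = u ⊕ v`, the upper right block of
the tautological representation can be moved into a complement of the coboundaries. -/
theorem exists_normalized_family [Fintype Δ] [∀ a b : Δ, Fintype (a ⟶ b)]
    (U : Set (ArrowMatrices k d d)) (hU : U.Nonempty)
    (hirr : ∀ f g : MvPolynomial (ArrowIndex d d) k, (∀ M ∈ U, aeval M.entries (f * g) = 0) →
      (∀ M ∈ U, aeval M.entries f = 0) ∨ ∀ M ∈ U, aeval M.entries g = 0)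
    (S : Splitting k d d' d'') (u : ArrowMatrices k d' d') (v : ArrowMatrices k d'' d'')
    (hN : InClosure U (S.assemble u 0 0 v)) (P : VertexIndex d'' d' → ArrowIndex d'' d' → k)
    (hP : ∀ (x : VertexIndex d'' d' → k) t,
      ∑ s, P t s * (coboundary u v (VertexMatrices.ofEntries x)).entries s = x t) :
    ∃ (A : Type (max u v)) (_ : CommRing A) (_ : IsDomain A) (_ : Algebra k A),
      Algebra.FiniteType k A ∧ ∃ (M : ArrowMatrices A d d) (h : VertexMatrices A d'' d')
        (φ : A →ₐ[k] k), InClosure U M ∧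
        (∀ f : MvPolynomial (ArrowIndex d d) k, aeval M.entries f = 0 →
          ∀ L ∈ U, aeval L.entries f = 0) ∧
        M.map φ = S.assemble u 0 0 v ∧ h.map φ = 0 ∧
        ∀ t, ∑ s, algebraMap k A (P t s) *
          ((S.map (algebraMap k A)).upperRight M h).entries s = 0 := by
  classical
  -- The vanishing ideal of `U`, prime by irreducibility. `B` is the coordinate ring of the closure,
  -- `MB` its tautological representation and `ψ` the point `u ⊕ v`.
  let I : Ideal (MvPolynomial (ArrowIndex d d) k) :=
    ⨅ L : U, RingHom.ker (aeval (R := k) (L : ArrowMatrices k d d).entries)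
  have hI : ∀ f, f ∈ I ↔ ∀ L ∈ U, aeval L.entries f = 0 := by
    intro f
    simp only [I, Submodule.mem_iInf, RingHom.mem_ker, Subtype.forall]
  have : I.IsPrime := by
    refine Ideal.isPrime_iff.2 ⟨?_, fun {f g} hfg => ?_⟩
    · rw [Ideal.ne_top_iff_one, hI]
      obtain ⟨L, hL⟩ := hU
      intro h
      simpa using h L hL
    · rw [hI] at hfg
      rw [hI, hI]
      exact hirr f g hfg
  let B := MvPolynomial (ArrowIndex d d) k ⧸ I
  let MB : ArrowMatrices B d d := ArrowMatrices.ofEntries fun s => Ideal.Quotient.mkₐ k I (X s)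
  have hMB : ∀ f, aeval MB.entries f = Ideal.Quotient.mk I f := by
    intro f
    have := MvPolynomial.comp_aeval_apply (R := k) X (Ideal.Quotient.mkₐ k I) f
    rw [aeval_X_left_apply] at this
    exact this.symm
  let ψ : B →ₐ[k] k := Ideal.Quotient.liftₐ I (aeval (S.assemble u 0 0 v).entries)
    fun f hf => hN f ((hI f).1 hf)
  have hψ : MB.map ψ = S.assemble u 0 0 v := by
    refine ArrowMatrices.entries_injective (funext fun s => ?_)
    change aeval (S.assemble u 0 0 v).entries (X s) = _
    rw [aeval_X]
  let τ := VertexIndex d'' d'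
  let T := S.map (A' := MvPolynomial τ B) (algebraMap k (MvPolynomial τ B))
  let z : ArrowMatrices (MvPolynomial τ B) d'' d' :=
    T.upperRight (MB.map C) (VertexMatrices.ofEntries X)
  -- `P` applied to the upper right block, with the entries of `h` as unknowns: there are as many
  -- equations as unknowns.
  let F : τ → MvPolynomial τ B := fun t =>
    ∑ s, algebraMap k (MvPolynomial τ B) (P t s) * z.entries s
  let ev : MvPolynomial τ B →+* k := eval₂Hom (ψ : B →+* k) (0 : τ → k)
  have hevC : ∀ b, ev (C b) = ψ b := fun b => by simp [ev]
  have hevX : ∀ t, ev (X t) = 0 := fun t => by simp [ev]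
  have hevk : ∀ c, ev (algebraMap k _ c) = c := fun c => by
    rw [IsScalarTower.algebraMap_apply k B, algebraMap_eq, hevC, AlgHom.commutes]
    rfl
  obtain ⟨J, hJ, hJB, hJF, φ, hφB, hφX⟩ := exists_domain_solution ψ F (by
    intro t
    change ev (∑ s, _) = 0
    rw [map_sum]
    refine Finset.sum_eq_zero fun s _ => ?_
    have hz : z.map ev = 0 := by
      rw [Splitting.upperRight_map, ← S.upperRight_assemble_zero u v]
      congr 1
      · change S.map (ev.comp (algebraMap k (MvPolynomial τ B))) = S.map (RingHom.id k)
        congr 1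
        exact RingHom.ext hevk
      · rw [← hψ, ArrowMatrices.map_map]
        congr 1
        exact funext hevC
      · rw [VertexMatrices.ofEntries_map]
        funext x
        ext r s
        exact hevX _
    have hz' : ev (z.entries s) = 0 := congrFun (congrArg ArrowMatrices.entries hz) s
    rw [map_mul, hz', mul_zero]) (by
    intro t t'
    -- The Jacobian at `h = 0` is `P` composed with the coboundary, that is, the identity.
    have hd := S.pderiv_upperRight_map MB u v ψ hψ t ev hevC hevX
    change ev (pderiv t (∑ s, _)) = _
    have hsum : ev (pderiv t (∑ s, algebraMap k (MvPolynomial τ B) (P t' s) * z.entries s)) =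
        ∑ s, P t' s *
          (coboundary u v (VertexMatrices.ofEntries (Pi.single t 1))).entries s := by
      rw [map_sum, map_sum]
      refine Finset.sum_congr rfl fun s _ => ?_
      rw [← hd, ArrowMatrices.entries_map, ArrowMatrices.entries_map, Derivation.leibniz,
        IsScalarTower.algebraMap_apply k B, algebraMap_eq, pderiv_C, smul_zero, add_zero,
        smul_eq_mul, map_mul, hevC, AlgHom.commutes]
      rfl
    rw [hsum, hP, Pi.single_apply]
    simp only [eq_comm])
  let A := MvPolynomial (τ ⊕ Unit) B ⧸ J
  let ι : B →ₐ[k] A := (Ideal.Quotient.mkₐ k J).comp (IsScalarTower.toAlgHom k B _)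
  let ρ : MvPolynomial τ B →ₐ[k] A :=
    (Ideal.Quotient.mkₐ k J).comp ((rename Sum.inl : _ →ₐ[B] _).restrictScalars k)
  have hρC : ∀ b, ρ (C b) = ι b := fun b => by
    change Ideal.Quotient.mk J (rename Sum.inl (C b)) = _
    rw [rename_C]
    rfl
  have hφι : ∀ b, φ (ι b) = ψ b := hφB
  have : Algebra.FiniteType k B := inferInstance
  have : Algebra.FiniteType k (MvPolynomial (τ ⊕ Unit) B) :=
    Algebra.FiniteType.trans (S := B) ‹_› inferInstance
  have : Algebra.FiniteType k A :=
    Algebra.FiniteType.of_surjective (Ideal.Quotient.mkₐ k J) Ideal.Quotient.mk_surjective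
  refine ⟨A, inferInstance, inferInstance, inferInstance, this, MB.map ι,
    (VertexMatrices.ofEntries X : VertexMatrices (MvPolynomial τ B) d'' d').map ρ, φ,
    ?_, ?_, ?_, ?_, ?_⟩
  · intro f hf
    rw [MB.aeval_entries_map, hMB, Ideal.Quotient.eq_zero_iff_mem.2 ((hI f).2 hf), map_zero]
  · intro f hf
    rw [MB.aeval_entries_map, hMB] at hf
    exact (hI f).1 (Ideal.Quotient.eq_zero_iff_mem.1
      (hJB _ (Ideal.Quotient.eq_zero_iff_mem.1 hf)))
  · rw [ArrowMatrices.map_map, ← hψ]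
    congr 1
    exact funext hφι
  · funext x
    ext r s
    change φ (Ideal.Quotient.mk J (rename Sum.inl (X _))) = 0
    rw [rename_X, hφX]
  · intro t
    have h1 : ρ (F t) = 0 := Ideal.Quotient.eq_zero_iff_mem.2 (hJF t)
    rw [map_sum] at h1
    rw [← h1]
    refine Finset.sum_congr rfl fun s _ => ?_
    rw [map_mul, AlgHom.commutes]
    congr 1
    have h2 := T.upperRight_map (ρ : MvPolynomial τ B →+* A) (MB.map C)
      (VertexMatrices.ofEntries X)
    have h3 : T.map (ρ : MvPolynomial τ B →+* A) = S.map (algebraMap k A) := by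
      change S.map ((ρ : MvPolynomial τ B →+* A).comp (algebraMap k (MvPolynomial τ B))) = _
      congr 1
      exact ρ.comp_algebraMap
    have h4 : (MB.map C).map ρ = MB.map ι := by
      rw [ArrowMatrices.map_map]
      congr 1
      exact funext hρC
    rw [h3] at h2
    change _ = ((z.map ρ).entries s)
    rw [show z.map ρ = _ from h2, ← h4]
    rfl

end Closure

/-! ### Nonsplit extensions as limits of rescaled families -/

section NonsplitExtension

open MvPolynomial

variable {k : Type u} [Field k] {Δ : Type v} [Quiver.{v} Δ] {d d' d'' : Δ → ℕ}

namespace Splitting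

variable {A : Type*} [CommRing A] (S : Splitting A d d' d'') (u : ArrowMatrices A d' d')
  (v : ArrowMatrices A d'' d'')

theorem upperLeft_assemble_zero : S.upperLeft (S.assemble u 0 0 v) 0 = u := by
  funext a b α
  simp [upperLeft, S.p_assemble_i]

theorem lowerLeft_assemble_zero : S.lowerLeft (S.assemble u 0 0 v) = 0 := by
  funext a b α
  simp [lowerLeft, S.q_assemble_i]

theorem lowerRight_assemble_zero : S.lowerRight (S.assemble u 0 0 v) 0 = v := by
  funext a b α
  simp [lowerRight, S.q_assemble_j]

end Splitting

/-- Let `N = u ⊕ v` be a point of the closure of `U` with `Hom(v, u) = 0`, such that no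
representation in `U` has a subrepresentation close to `v`.  Then the closure of `U` contains a
nonsplit extension of `v` by `u`. -/
theorem exists_nonsplit_extension_inClosure [IsAlgClosed k] [Fintype Δ]
    [∀ a b : Δ, Fintype (a ⟶ b)] (U : Set (ArrowMatrices k d d)) (hstable : IsStable U)
    (hirr : ∀ f g : MvPolynomial (ArrowIndex d d) k, (∀ M ∈ U, aeval M.entries (f * g) = 0) →
      (∀ M ∈ U, aeval M.entries f = 0) ∨ ∀ M ∈ U, aeval M.entries g = 0)
    (S : Splitting k d d' d'') (u : ArrowMatrices k d' d') (v : ArrowMatrices k d'' d'')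
    (hN : InClosure U (S.assemble u 0 0 v))
    (hinj : ∀ h : VertexMatrices k d'' d', Intertwines h v u → h = 0)
    (f₀ : MvPolynomial (ArrowIndex d d) k) (hf₀ : ∃ L ∈ U, aeval L.entries f₀ ≠ 0)
    (g₀ : MvPolynomial (ArrowIndex d'' d'') k) (hg₀ : aeval v.entries g₀ ≠ 0)
    (hno : ∀ M : ArrowMatrices k d d, InClosure U M → aeval M.entries f₀ ≠ 0 →
      ∀ b : ArrowMatrices k d'' d'', aeval b.entries g₀ ≠ 0 →
      ∀ J : VertexMatrices k d'' d, Intertwines J b M → (∀ x, S.q x * J x = 1) → False) :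
    ∃ ζ : ArrowMatrices k d'' d', InClosure U (S.assemble u ζ 0 v) ∧
      ∀ h, coboundary u v h ≠ ζ := by
  obtain ⟨P, hP⟩ := exists_coboundary_retraction u v hinj
  obtain ⟨A, _, _, _, _, M, h, φ, hM, hgen, hMφ, hhφ, hPz⟩ :=
    exists_normalized_family U (hf₀.imp fun _ h => h.1) hirr S u v hN P hP
  have hSmap : ∀ {A' : Type (max u v)} [CommRing A'] [Algebra k A'] (θ : A' →ₐ[k] k),
      (S.map (algebraMap k A')).map (θ : A' →+* k) = S := by
    intro A' _ _ θ
    change S.map ((θ : A' →+* k).comp (algebraMap k A')) = S.map (RingHom.id k)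
    congr 1
    exact θ.comp_algebraMap
  -- If the block vanishes, `j + ih` embeds a family `b` with special member `v` into `M`, contrary
  -- to `hno` at a general point.
  by_cases hz : (S.map (algebraMap k A)).upperRight M h = 0
  · exfalso
    have hb := ((S.map (algebraMap k A)).intertwines_of_upperRight_eq_zero M h hz)
    set b := (S.map (algebraMap k A)).lowerRight M h
    have hbφ : b.map φ = v := by
      have := (S.map (algebraMap k A)).lowerRight_map (φ : A →+* k) M h
      rw [hSmap] at this
      refine this.trans ?_
      rw [show M.map (φ : A →+* k) = _ from hMφ, show h.map (φ : A →+* k) = _ from hhφ,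
        S.lowerRight_assemble_zero]
    have h1 : aeval M.entries f₀ ≠ 0 := by
      intro h0
      obtain ⟨L, hL, hLf⟩ := hf₀
      exact hLf (hgen f₀ h0 L hL)
    have h2 : aeval b.entries g₀ ≠ 0 := by
      intro h0
      rw [← hbφ, b.aeval_entries_map, h0, map_zero] at hg₀
      exact hg₀ rfl
    -- `f₀` is nonzero on `M` because `M` is generic in `U`, and `g₀` is nonzero on `b` because it
    -- is so at the special point; a single `k`-point serves both.
    obtain ⟨θ, hθ⟩ := exists_algHom_apply_ne_zero (k := k) (mul_ne_zero h1 h2)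
    rw [map_mul, ← ArrowMatrices.aeval_entries_map, ← ArrowMatrices.aeval_entries_map] at hθ
    refine hno (M.map θ) (hM.map θ) (left_ne_zero_of_mul hθ) (b.map θ) (right_ne_zero_of_mul hθ)
      _ (hb.map (θ : A →+* k)) fun x => ?_
    have hq : S.q x = ((S.map (algebraMap k A)).q x).map (θ : A →+* k) :=
      congrFun (congrArg Splitting.q (hSmap θ)).symm x
    rw [hq, VertexMatrices.map_apply, ← Matrix.map_mul, Matrix.mul_add, Splitting.q_j,
      Splitting.q_i_assoc, add_zero, Matrix.map_one _ (map_zero _) (map_one _)]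
  · obtain ⟨A', _, _, _, ι, s₀, w, θ, _, ht, hw₀, hw, hθ⟩ := exists_affine_domain_divides φ
      ((S.map (algebraMap k A)).upperRight M h).entries
      fun h0 => hz (ArrowMatrices.entries_injective h0)
    set t := ι (((S.map (algebraMap k A)).upperRight M h).entries s₀)
    have hSι : (S.map (algebraMap k A)).map (ι : A →+* A') = S.map (algebraMap k A') := by
      change S.map ((ι : A →+* A').comp (algebraMap k A)) = _
      congr 1
      exact ι.comp_algebraMap
    let T := S.map (algebraMap k A')
    let W : ArrowMatrices A' d'' d' := ArrowMatrices.ofEntries w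
    have hzW : T.upperRight (M.map ι) (h.map ι) = t • W := by
      have := (S.map (algebraMap k A)).upperRight_map (ι : A →+* A') M h
      rw [hSι] at this
      refine this.symm.trans (ArrowMatrices.entries_injective (funext fun s => ?_))
      exact hw s
    -- The rescaled family, defined also where `t = 0`; over the points with `t ≠ 0` it is
    -- isomorphic to `M`.
    let N' := T.assemble (T.upperLeft (M.map ι) (h.map ι)) W (t • T.lowerLeft (M.map ι))
      (T.lowerRight (M.map ι) (h.map ι))
    have hN' : InClosure U N' := by
      refine hstable.inClosure_of_generic ht (hM.map ι) fun η hη => ?_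
      refine ⟨_, fun x => S.i x * S.p x + (η t)⁻¹ • (S.i x * (((h.map ι).map η) x * S.q x)) +
        (η t)⁻¹ • (S.j x * S.q x),
        S.rescale_mul ((h.map ι).map η) (η t) (η t)⁻¹ (mul_inv_cancel₀ hη), ?_⟩
      have h1 := S.intertwines_rescale ((M.map ι).map η) ((h.map ι).map η) (η t) (W.map η) (by
        have := T.upperRight_map (η : A' →+* k) (M.map ι) (h.map ι)
        rw [hSmap, hzW] at this
        refine this.symm.trans ?_
        funext a b α
        ext r s
        exact map_mul η _ _)
      convert h1 using 1
      have h2 := T.assemble_map (η : A' →+* k) (T.upperLeft (M.map ι) (h.map ι)) W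
        (t • T.lowerLeft (M.map ι)) (T.lowerRight (M.map ι) (h.map ι))
      rw [T.upperLeft_map, T.lowerRight_map, hSmap] at h2
      refine h2.trans ?_
      congr 1
      rw [← show (T.lowerLeft (M.map ι)).map (η : A' →+* k) = S.lowerLeft ((M.map ι).map η) by
        rw [T.lowerLeft_map, hSmap]; rfl]
      funext a b α
      ext r s
      exact map_mul η _ _
    have hMθ : (M.map ι).map θ = S.assemble u 0 0 v := by
      rw [← hMφ, ArrowMatrices.map_map]
      congr 1
      exact funext hθ
    have hhθ : (h.map ι).map θ = 0 := by
      rw [← hhφ, VertexMatrices.map_map]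
      congr 1
      exact funext hθ
    have hζ : N'.map θ = S.assemble u (W.map θ) 0 v := by
      have h2 := T.assemble_map (θ : A' →+* k) (T.upperLeft (M.map ι) (h.map ι)) W
        (t • T.lowerLeft (M.map ι)) (T.lowerRight (M.map ι) (h.map ι))
      rw [T.upperLeft_map, T.lowerRight_map, hSmap] at h2
      refine h2.trans ?_
      rw [show (M.map ι).map (θ : A' →+* k) = _ from hMθ,
        show (h.map ι).map (θ : A' →+* k) = _ from hhθ, S.upperLeft_assemble_zero,
        S.lowerRight_assemble_zero]
      congr 1
      have h3 : (T.lowerLeft (M.map ι)).map (θ : A' →+* k) = 0 := by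
        rw [T.lowerLeft_map, hSmap, show (M.map ι).map (θ : A' →+* k) = _ from hMθ,
          S.lowerLeft_assemble_zero]
      funext a b α
      ext r s
      refine (map_mul θ _ _).trans ?_
      rw [show θ _ = 0 from congrFun (congrFun (congrFun (congrFun (congrFun h3 a) b) α) r) s,
        mul_zero]
      rfl
    refine ⟨W.map θ, hζ ▸ hN'.map θ, fun y hy => ?_⟩
    -- `P` kills `z = t w`, and `t` can be cancelled in the domain `A'`.
    have hPw : ∀ τ, ∑ s, algebraMap k A' (P τ s) * w s = 0 := by
      intro τ
      refine (mul_eq_zero.1 ?_).resolve_left ht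
      have h1 := congrArg ι (hPz τ)
      rw [map_sum, map_zero] at h1
      rw [← h1, Finset.mul_sum]
      refine Finset.sum_congr rfl fun s _ => ?_
      rw [map_mul, ι.commutes, show ι _ = _ from hw s]
      ring
    -- If the block is the coboundary of `y`, applying `P` gives `y = 0`. The block would then
    -- vanish, but its entry at `s₀` is `1`.
    have hy0 : y = 0 := by
      funext x
      ext r s
      have h1 := hP (fun τ => y τ.1 τ.2.1 τ.2.2) ⟨x, r, s⟩
      change ∑ s, P _ s * (coboundary u v y).entries s = y x r s at h1
      rw [← h1, hy]
      have h2 := congrArg θ (hPw ⟨x, r, s⟩)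
      rw [map_sum, map_zero] at h2
      refine (Finset.sum_congr rfl fun s _ => ?_).trans h2
      rw [map_mul, θ.commutes]
      rfl
    rw [hy0, map_zero] at hy
    have h1 : (0 : k) = θ (w s₀) := congrFun (congrArg ArrowMatrices.entries hy) s₀
    rw [hw₀, map_one] at h1
    exact zero_ne_one h1

end NonsplitExtension

section Hom

variable {k : Type u} [Field k] {Δ : Type v} [Quiver.{v} Δ] {d d' d'' : Δ → ℕ}

/-! ## Dimensions of spaces of morphisms -/

/-- The space of the morphisms from `M` to `N`. -/
def homSpace (M : ArrowMatrices k d d) (N : ArrowMatrices k d' d') :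
    Submodule k (VertexMatrices k d d') where
  carrier := {f | Intertwines f M N}
  zero_mem' a b α := by simp
  add_mem' hf hg a b α := by
    simp only [Pi.add_apply, Matrix.mul_add, Matrix.add_mul, hf a b α, hg a b α]
  smul_mem' c f hf a b α := by
    simp only [Pi.smul_apply, Matrix.mul_smul, Matrix.smul_mul, hf a b α]

theorem Intertwines.comp {A : Type*} [CommRing A] {f : VertexMatrices A d d'}
    {g : VertexMatrices A d' d''} {L : ArrowMatrices A d d} {M : ArrowMatrices A d' d'}
    {N : ArrowMatrices A d'' d''} (hg : Intertwines g M N) (hf : Intertwines f L M) :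
    Intertwines (fun x => g x * f x) L N := fun a b α => by
  rw [← Matrix.mul_assoc, hg a b α, Matrix.mul_assoc, hf a b α, Matrix.mul_assoc]

theorem intertwines_one {A : Type*} [CommRing A] (M : ArrowMatrices A d d) :
    Intertwines (fun _ => 1) M M := fun a b α => by
  rw [Matrix.mul_one, Matrix.one_mul]

theorem Intertwines.inverse {A : Type*} [CommRing A] {g g' : VertexMatrices A d d}
    {M N : ArrowMatrices A d d} (hg : ∀ x, g x * g' x = 1) (h : Intertwines g M N) :
    Intertwines g' N M := fun a b α => by
  calc M a b α * g' a = g' b * g b * (M a b α * g' a) := by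
        rw [mul_eq_one_comm.1 (hg b), Matrix.one_mul]
    _ = g' b * (g b * M a b α) * g' a := by simp only [Matrix.mul_assoc]
    _ = g' b * N a b α := by rw [← h a b α]; simp only [Matrix.mul_assoc, hg, Matrix.mul_one]

namespace Splitting

variable {A : Type*} [CommRing A] (S : Splitting A d d' d'') (u : ArrowMatrices A d' d')
  (z : ArrowMatrices A d'' d') (v : ArrowMatrices A d'' d'')

theorem intertwines_i : Intertwines S.i u (S.assemble u z 0 v) := fun a b α => by
  simp [assemble, Matrix.add_mul, Matrix.mul_assoc, S.p_i, S.q_i]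

theorem intertwines_q : Intertwines S.q (S.assemble u z 0 v) v := fun a b α => by
  simp [assemble, Matrix.mul_add, S.q_i_assoc, S.q_j_assoc]

theorem intertwines_j : Intertwines S.j v (S.assemble u 0 0 v) := fun a b α => by
  simp [assemble, Matrix.add_mul, Matrix.mul_assoc, S.p_j, S.q_j]

theorem intertwines_p : Intertwines S.p (S.assemble u 0 0 v) u := fun a b α => by
  simp [assemble, Matrix.mul_add, S.p_i_assoc, S.p_j_assoc]

theorem assemble_mul_j {a b : Δ} (α : a ⟶ b) :
    S.assemble u z 0 v a b α * S.j a = S.i b * z a b α + S.j b * v a b α := by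
  simp [assemble, Matrix.add_mul, Matrix.mul_assoc, S.p_j, S.q_j]

theorem p_mul_assemble {a b : Δ} (α : a ⟶ b) :
    S.p b * S.assemble u z 0 v a b α = u a b α * S.p a + z a b α * S.q a := by
  simp [assemble, Matrix.mul_add, S.p_i_assoc, S.p_j_assoc]

theorem eq_i_mul {x : Δ} {m : Type*} {X : Matrix (Fin (d x)) m A} (h : S.q x * X = 0) :
    X = S.i x * (S.p x * X) := by
  calc X = (S.i x * S.p x + S.j x * S.q x) * X := by rw [S.add, Matrix.one_mul]
    _ = _ := by rw [Matrix.add_mul, Matrix.mul_assoc, Matrix.mul_assoc, h, Matrix.mul_zero, add_zero]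

theorem eq_mul_q {x : Δ} {m : Type*} {X : Matrix m (Fin (d x)) A} (h : X * S.i x = 0) :
    X = X * S.j x * S.q x := by
  calc X = X * (S.i x * S.p x + S.j x * S.q x) := by rw [S.add, Matrix.mul_one]
    _ = _ := by rw [Matrix.mul_add, ← Matrix.mul_assoc, h, Matrix.zero_mul, zero_add,
      Matrix.mul_assoc]

end Splitting

/-- Rank-nullity for `α`, whose kernel is embedded into `A` by `β`. -/
theorem finrank_le_of_ker_le {V E F : Type*} [AddCommGroup V] [Module k V] [AddCommGroup E]
    [Module k E] [AddCommGroup F] [Module k F] [FiniteDimensional k V] [FiniteDimensional k E]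
    (α : V →ₗ[k] F) (β : V →ₗ[k] E) (A : Submodule k E) (hA : ∀ f, α f = 0 → β f ∈ A)
    (hinj : ∀ f, α f = 0 → β f = 0 → f = 0) :
    Module.finrank k V ≤ Module.finrank k A + Module.finrank k (LinearMap.range α) := by
  rw [← LinearMap.finrank_range_add_finrank_ker α, add_comm]
  gcongr
  let γ : LinearMap.ker α →ₗ[k] A :=
    (β ∘ₗ (LinearMap.ker α).subtype).codRestrict A fun f => hA f f.2
  refine LinearMap.finrank_le_finrank_of_injective (f := γ) ?_
  rw [← LinearMap.ker_eq_bot, LinearMap.ker_eq_bot']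
  intro f hf
  exact Subtype.ext (hinj f f.2 (congrArg Subtype.val hf))

section Finite

variable [Fintype Δ]

/-- Composition with a family of matrices on the left. -/
def VertexMatrices.mulLeft (g : VertexMatrices k d' d'') (d : Δ → ℕ) :
    VertexMatrices k d d' →ₗ[k] VertexMatrices k d d'' where
  toFun f x := g x * f x
  map_add' _ _ := funext fun _ => Matrix.mul_add _ _ _
  map_smul' c f := funext fun x => Matrix.mul_smul (g x) c (f x)

/-- Composition with a family of matrices on the right. -/
def VertexMatrices.mulRight (g : VertexMatrices k d d') (d'' : Δ → ℕ) :
    VertexMatrices k d' d'' →ₗ[k] VertexMatrices k d d'' where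
  toFun f x := f x * g x
  map_add' _ _ := funext fun _ => Matrix.add_mul _ _ _
  map_smul' c f := funext fun x => Matrix.smul_mul c (f x) (g x)

variable (S : Splitting k d d' d'') (u : ArrowMatrices k d' d') (z : ArrowMatrices k d'' d')
  (v : ArrowMatrices k d'' d'')

/-- Left exactness of `Hom(T, -)` on the extension. The image in `Hom(T, v)` is kept explicit, since
the strict inequality comes from its being a proper subspace when `T = v`. -/
theorem finrank_homSpace_to_le {e : Δ → ℕ} (T : ArrowMatrices k e e) :
    Module.finrank k (homSpace T (S.assemble u z 0 v)) ≤
      Module.finrank k (homSpace T u) +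
        Module.finrank k (LinearMap.range ((VertexMatrices.mulLeft S.q e).restrict
          (p := homSpace T (S.assemble u z 0 v)) (q := homSpace T v)
          fun _ hf => (S.intertwines_q u z v).comp hf)) := by
  refine finrank_le_of_ker_le _ ((VertexMatrices.mulLeft S.p e).domRestrict _) _ ?_ ?_
  · intro f hf a b α
    have hq : ∀ x, S.q x * f.1 x = 0 := fun x => congrFun (congrArg Subtype.val hf) x
    change u a b α * (S.p a * f.1 a) = S.p b * f.1 b * T a b α
    rw [Matrix.mul_assoc, ← f.2 a b α, ← Matrix.mul_assoc (S.p b), S.p_mul_assemble,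
      Matrix.add_mul, Matrix.mul_assoc (z a b α), hq, Matrix.mul_zero, add_zero, Matrix.mul_assoc]
  · intro f hf hf'
    have hq : ∀ x, S.q x * f.1 x = 0 := fun x => congrFun (congrArg Subtype.val hf) x
    have hp : ∀ x, S.p x * f.1 x = 0 := fun x => congrFun hf' x
    refine Subtype.ext (funext fun x => ?_)
    rw [S.eq_i_mul (hq x), hp, Matrix.mul_zero]
    rfl

/-- Left exactness of `Hom(-, T)` on the same extension. -/
theorem finrank_homSpace_from_le {e : Δ → ℕ} (T : ArrowMatrices k e e) :
    Module.finrank k (homSpace (S.assemble u z 0 v) T) ≤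
      Module.finrank k (homSpace v T) + Module.finrank k (homSpace u T) := by
  refine (finrank_le_of_ker_le ((VertexMatrices.mulRight S.i e).restrict
    (p := homSpace (S.assemble u z 0 v) T) (q := homSpace u T)
    fun _ hf => Intertwines.comp hf (S.intertwines_i u z v))
    ((VertexMatrices.mulRight S.j e).domRestrict _) (homSpace v T) ?_ ?_).trans ?_
  · intro f hf a b α
    have hi : ∀ x, f.1 x * S.i x = 0 := fun x => congrFun (congrArg Subtype.val hf) x
    change T a b α * (f.1 a * S.j a) = f.1 b * S.j b * v a b α
    rw [← Matrix.mul_assoc, f.2 a b α, Matrix.mul_assoc, S.assemble_mul_j, Matrix.mul_add,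
      ← Matrix.mul_assoc, hi, Matrix.zero_mul, zero_add, Matrix.mul_assoc]
  · intro f hf hf'
    have hi : ∀ x, f.1 x * S.i x = 0 := fun x => congrFun (congrArg Subtype.val hf) x
    have hj : ∀ x, f.1 x * S.j x = 0 := fun x => congrFun hf' x
    refine Subtype.ext (funext fun x => ?_)
    rw [S.eq_mul_q (hi x), hj, Matrix.zero_mul]
    rfl
  · gcongr
    exact Submodule.finrank_le _

/-- The identity of `v` does not lift to the extension: for a lift `f`, the class `z` would be the
coboundary of `-pf`. -/
theorem finrank_homSpace_lt (hz : ∀ h, coboundary u v h ≠ z) :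
    Module.finrank k (homSpace v (S.assemble u z 0 v)) <
      Module.finrank k (homSpace v u) + Module.finrank k (homSpace v v) := by
  refine (finrank_homSpace_to_le S u z v v).trans_lt ?_
  gcongr
  refine Submodule.finrank_lt fun htop => ?_
  rw [LinearMap.range_eq_top] at htop
  obtain ⟨f, hf⟩ := htop ⟨fun _ => 1, intertwines_one v⟩
  have hq : ∀ x, S.q x * f.1 x = 1 := fun x => congrFun (congrArg Subtype.val hf) x
  refine hz (fun x => -(S.p x * f.1 x)) ?_
  funext a b α
  have h1 := congrArg (S.p b * ·) (f.2 a b α)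
  simp only [← Matrix.mul_assoc, S.p_mul_assemble] at h1
  rw [Matrix.add_mul, Matrix.mul_assoc (z a b α), hq, Matrix.mul_one] at h1
  rw [coboundary_apply, Matrix.mul_neg, Matrix.neg_mul, ← h1, Matrix.mul_assoc]
  abel

/-- The four spaces of morphisms embed as the four blocks of an endomorphism of `u ⊕ v`; only this
inequality is needed. -/
theorem finrank_homSpace_assemble_zero :
    Module.finrank k (homSpace u u) + Module.finrank k (homSpace u v) +
      (Module.finrank k (homSpace v u) + Module.finrank k (homSpace v v)) ≤
      Module.finrank k (homSpace (S.assemble u 0 0 v) (S.assemble u 0 0 v)) := by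
  have hmem : ∀ {e e' : Δ → ℕ} {X : ArrowMatrices k e e} {Y : ArrowMatrices k e' e'}
      {i : VertexMatrices k e' d} {p : VertexMatrices k d e}
      (_ : Intertwines i Y (S.assemble u 0 0 v)) (_ : Intertwines p (S.assemble u 0 0 v) X)
      (f : VertexMatrices k e e'), f ∈ homSpace X Y →
      (VertexMatrices.mulLeft i d ∘ₗ VertexMatrices.mulRight p e') f ∈
        homSpace (S.assemble u 0 0 v) (S.assemble u 0 0 v) :=
    fun hi hp _ hf => hi.comp (Intertwines.comp hf hp)
  let Φ := ((LinearMap.restrict _ (hmem (S.intertwines_i u 0 v) (S.intertwines_p u v))).coprod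
    (LinearMap.restrict _ (hmem (S.intertwines_j u v) (S.intertwines_p u v)))).coprod
    ((LinearMap.restrict _ (hmem (S.intertwines_i u 0 v) (S.intertwines_q u 0 v))).coprod
    (LinearMap.restrict _ (hmem (S.intertwines_j u v) (S.intertwines_q u 0 v))))
  have hΦ : Function.Injective Φ := by
    rw [← LinearMap.ker_eq_bot, LinearMap.ker_eq_bot']
    rintro ⟨⟨f, g⟩, f', g'⟩ h
    have hx : ∀ x, S.i x * (f.1 x * S.p x) + S.j x * (g.1 x * S.p x) +
        (S.i x * (f'.1 x * S.q x) + S.j x * (g'.1 x * S.q x)) = 0 :=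
      fun x => congrFun (congrArg Subtype.val h) x
    have h1 : f = 0 := Subtype.ext (funext fun x => by
      simpa [Matrix.mul_add, Matrix.add_mul, Matrix.mul_assoc, S.p_i_assoc, S.p_j_assoc, S.p_i,
        S.q_i] using congrArg (fun X => S.p x * (X * S.i x)) (hx x))
    have h2 : g = 0 := Subtype.ext (funext fun x => by
      simpa [Matrix.mul_add, Matrix.add_mul, Matrix.mul_assoc, S.q_i_assoc, S.q_j_assoc, S.p_i,
        S.q_i] using congrArg (fun X => S.q x * (X * S.i x)) (hx x))
    have h3 : f' = 0 := Subtype.ext (funext fun x => by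
      simpa [Matrix.mul_add, Matrix.add_mul, Matrix.mul_assoc, S.p_i_assoc, S.p_j_assoc, S.p_j,
        S.q_j] using congrArg (fun X => S.p x * (X * S.j x)) (hx x))
    have h4 : g' = 0 := Subtype.ext (funext fun x => by
      simpa [Matrix.mul_add, Matrix.add_mul, Matrix.mul_assoc, S.q_i_assoc, S.q_j_assoc, S.p_j,
        S.q_j] using congrArg (fun X => S.q x * (X * S.j x)) (hx x))
    rw [h1, h2, h3, h4]
    rfl
  have := LinearMap.finrank_le_finrank_of_injective hΦ
  rwa [Module.finrank_prod, Module.finrank_prod, Module.finrank_prod] at this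

/-- The endomorphism algebra of a nonsplit extension is smaller than the one of the direct sum. -/
theorem finrank_end_lt (hz : ∀ h, coboundary u v h ≠ z) :
    Module.finrank k (homSpace (S.assemble u z 0 v) (S.assemble u z 0 v)) <
      Module.finrank k (homSpace (S.assemble u 0 0 v) (S.assemble u 0 0 v)) := by
  have h1 := finrank_homSpace_from_le S u z v (S.assemble u z 0 v)
  have h2 := finrank_homSpace_lt S u z v hz
  have h3 := (finrank_homSpace_to_le S u z v u).trans
    (Nat.add_le_add_left (Submodule.finrank_le _) _)
  have h4 := finrank_homSpace_assemble_zero S u v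
  omega

end Finite

/-! ## Splittings defined by idempotents -/

/-- Choose a basis of the image of `e`: `j` is its inclusion and `q` the projection onto it. -/
theorem Matrix.exists_factorization_of_idempotent {n : ℕ} (e : Matrix (Fin n) (Fin n) k)
    (he : e * e = e) : ∃ (r : ℕ) (j : Matrix (Fin n) (Fin r) k) (q : Matrix (Fin r) (Fin n) k),
      q * j = 1 ∧ j * q = e := by
  let E := e.mulVecLin
  let b := Module.finBasis k (LinearMap.range E)
  let J : (Fin _ → k) →ₗ[k] (Fin n → k) :=
    (LinearMap.range E).subtype ∘ₗ b.equivFun.symm.toLinearMap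
  let Q : (Fin n → k) →ₗ[k] (Fin _ → k) := b.equivFun.toLinearMap ∘ₗ E.rangeRestrict
  refine ⟨_, LinearMap.toMatrix' J, LinearMap.toMatrix' Q, ?_, ?_⟩
  · rw [← LinearMap.toMatrix'_comp, ← LinearMap.toMatrix'_id]
    congr 1
    refine LinearMap.ext fun x => ?_
    have h1 : ∀ y : LinearMap.range E, E.rangeRestrict y = y := by
      rintro ⟨_, y, rfl⟩
      refine Subtype.ext ?_
      change e.mulVec (e.mulVec y) = e.mulVec y
      rw [Matrix.mulVec_mulVec, he]
    change b.equivFun (E.rangeRestrict (b.equivFun.symm x : LinearMap.range E)) = x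
    rw [h1, LinearEquiv.apply_symm_apply]
  · rw [← LinearMap.toMatrix'_comp]
    have : J ∘ₗ Q = E := by
      refine LinearMap.ext fun x => ?_
      change ((b.equivFun.symm (b.equivFun (E.rangeRestrict x)) : LinearMap.range E) : Fin n → k) = _
      rw [LinearEquiv.symm_apply_apply]
      rfl
    rw [this]
    exact LinearMap.toMatrix'_toLin' e

theorem exists_splitting_of_idempotent (e : VertexMatrices k d d) (he : ∀ x, e x * e x = e x) :
    ∃ (d' d'' : Δ → ℕ) (S : Splitting k d d' d''), ∀ x, S.j x * S.q x = e x := by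
  have he' : ∀ x, (1 - e x) * (1 - e x) = 1 - e x := fun x => by
    rw [Matrix.mul_sub, Matrix.sub_mul, Matrix.sub_mul, he]
    simp
  choose d'' j q hqj hjq using fun x => Matrix.exists_factorization_of_idempotent (e x) (he x)
  choose d' i p hpi hip using fun x =>
    Matrix.exists_factorization_of_idempotent (1 - e x) (he' x)
  refine ⟨d', d'', ⟨i, j, p, q, hpi, hqj, fun x => ?_, fun x => ?_, fun x => ?_⟩, hjq⟩
  · calc p x * j x = p x * i x * p x * (j x * q x * j x) := by
          rw [hpi, Matrix.one_mul, Matrix.mul_assoc (j x), hqj, Matrix.mul_one]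
      _ = p x * ((i x * p x) * (j x * q x)) * j x := by simp only [Matrix.mul_assoc]
      _ = 0 := by
          rw [hip, hjq, Matrix.sub_mul, he, Matrix.one_mul, sub_self, Matrix.mul_zero,
            Matrix.zero_mul]
  · calc q x * i x = q x * j x * q x * (i x * p x * i x) := by
          rw [hqj, Matrix.one_mul, Matrix.mul_assoc (i x), hpi, Matrix.mul_one]
      _ = q x * ((j x * q x) * (i x * p x)) * i x := by simp only [Matrix.mul_assoc]
      _ = 0 := by
          rw [hip, hjq, Matrix.mul_sub, he, Matrix.mul_one, sub_self, Matrix.mul_zero,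
            Matrix.zero_mul]
  · rw [hip, hjq, sub_add_cancel]

end Hom

/-! ## Degeneration of an extension to the direct sum -/

section Degeneration

open MvPolynomial

variable {k : Type u} [Field k] [Infinite k] {Δ : Type v} [Quiver.{v} Δ] {d d' d'' : Δ → ℕ}

/-- Along the line `t ↦ tz` all extensions with `t ≠ 0` are isomorphic to the given one. A
polynomial vanishing on `U` thus has infinitely many zeros on this line, so it vanishes at `t = 0`.
-/
theorem Splitting.inClosure_assemble_zero (S : Splitting k d d' d'') (u : ArrowMatrices k d' d')
    (z : ArrowMatrices k d'' d') (v : ArrowMatrices k d'' d'') (U : Set (ArrowMatrices k d d))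
    (hU : IsStable U) (hmem : S.assemble u z 0 v ∈ U) : InClosure U (S.assemble u 0 0 v) := by
  intro f hf
  let Z : ArrowMatrices (Polynomial k) d'' d' := fun a b α =>
    (Polynomial.X : Polynomial k) • (z a b α).map Polynomial.C
  let M : ArrowMatrices (Polynomial k) d d :=
    (S.map Polynomial.C).assemble (u.map Polynomial.C) Z 0 (v.map Polynomial.C)
  have hM : ∀ t : k, M.map (Polynomial.aeval t : Polynomial k →ₐ[k] k) =
      S.assemble u (t • z) 0 v := by
    intro t
    have h1 := (S.map Polynomial.C).assemble_map (Polynomial.evalRingHom t) (u.map Polynomial.C) Z 0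
      (v.map Polynomial.C)
    have hid : (Polynomial.evalRingHom t).comp Polynomial.C = RingHom.id k :=
      RingHom.ext fun c => by simp
    have h2 : ∀ {e e' : Δ → ℕ} (Y : ArrowMatrices k e e'),
        (Y.map Polynomial.C).map (Polynomial.evalRingHom t) = Y := fun Y => by
      funext a b α
      ext r s
      exact RingHom.congr_fun hid _
    have h3 : Z.map (Polynomial.evalRingHom t) = t • z := by
      funext a b α
      ext r s
      simp [Z]
      exact mul_comm _ _
    rw [h2, h2, h3] at h1
    refine h1.trans ?_
    have h4 : (S.map Polynomial.C).map (Polynomial.evalRingHom t) = S := by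
      change S.map ((Polynomial.evalRingHom t).comp Polynomial.C) = S.map (RingHom.id k)
      rw [hid]
    rw [h4]
    congr 1
    funext a b α
    ext r s
    simp
  have hF : aeval M.entries f = 0 := by
    refine Polynomial.eq_zero_of_infinite_isRoot _
      ((Set.finite_singleton (0 : k)).infinite_compl.mono fun t ht => ?_)
    change Polynomial.eval t _ = 0
    rw [← Polynomial.coe_aeval_eq_eval, ← M.aeval_entries_map, hM]
    refine hf _ (hU _ _ _ _ (fun x => mul_eq_one_comm.1
      (S.rescale_mul 0 t t⁻¹ (mul_inv_cancel₀ ht) x)) (Intertwines.inverse (fun x =>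
      S.rescale_mul 0 t t⁻¹ (mul_inv_cancel₀ ht) x) ?_) hmem)
    have h1 := S.intertwines_rescale (S.assemble u (t • z) 0 v) 0 t z (by
      funext a b α
      simp [upperRight, S.p_assemble_j])
    convert h1 using 1
    congr 1
    · funext a b α
      simp [upperLeft, S.p_assemble_i]
    · funext a b α
      simp [lowerLeft, S.q_assemble_i]
    · funext a b α
      simp [lowerRight, S.q_assemble_j]
  have := hM 0
  rw [zero_smul] at this
  rw [← this, M.aeval_entries_map, hF, map_zero]

end Degeneration

/-! ## The Zariski topology on the module varieties -/

section Topology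

open MvPolynomial

theorem mem_closure_zariski {k : Type*} [Field k] {ι : Type*} (T : Set (ι → k)) (x : ι → k) :
    x ∈ @closure _ (zariskiTopology k ι) T ↔
      ∀ f : MvPolynomial ι k, (∀ y ∈ T, eval y f = 0) → eval x f = 0 := by
  let _ := zariskiTopology k ι
  have hcl : ∀ Z : Set (ι → k), IsClosed Z ↔
      ∃ S : Set (MvPolynomial ι k), Z = {x | ∀ f ∈ S, eval x f = 0} := by
    intro Z
    rw [← isOpen_compl_iff]
    change Zᶜᶜ ∈ {Z : Set (ι → k) | ∃ S : Set (MvPolynomial ι k),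
      Z = {x | ∀ f ∈ S, eval x f = 0}} ↔ _
    rw [compl_compl]
    rfl
  constructor
  · intro hx f hf
    have h1 : IsClosed {y : ι → k | ∀ g ∈ ({f} : Set (MvPolynomial ι k)), eval y g = 0} :=
      (hcl _).2 ⟨_, rfl⟩
    exact closure_minimal (fun y hy g hg => by rw [hg]; exact hf y hy) h1 hx f rfl
  · intro h
    obtain ⟨S, hS⟩ := (hcl _).1 (isClosed_closure (s := T))
    rw [hS]
    intro f hf
    refine h f fun y hy => ?_
    have := subset_closure hy
    rw [hS] at this
    exact this f hf

namespace ModVariety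

variable {k : Type u} {Δ : Type v} [Quiver.{v} Δ] [Field k]
  {rel : ∀ a b : Δ, Set (Quiver.Path a b →₀ k)} {d d' d'' : Δ → ℕ}

/-- The representations underlying the points of `T`. -/
def reps (T : Set (ModVariety rel d)) : Set (ArrowMatrices k d d) := {M | ∃ N ∈ T, N.1 = M}

theorem forall_mem_reps {T : Set (ModVariety rel d)} {P : ArrowMatrices k d d → Prop} :
    (∀ M ∈ reps T, P M) ↔ ∀ M ∈ T, P M.1 :=
  ⟨fun h M hM => h _ ⟨M, hM, rfl⟩, by rintro h _ ⟨M, hM, rfl⟩; exact h M hM⟩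

theorem mem_closure_iff {T : Set (ModVariety rel d)} {N : ModVariety rel d} :
    N ∈ closure T ↔ InClosure (reps T) N.1 := by
  let _ := zariskiTopology k (ArrowIndex d d)
  refine (closure_induced (f := fun M : ModVariety rel d => M.1.coords)).trans
    ((mem_closure_zariski _ _).trans ?_)
  refine forall_congr' fun f => ?_
  rw [Set.forall_mem_image, forall_mem_reps]
  rfl

theorem isClosed_zeros (f : MvPolynomial (ArrowIndex d d) k) :
    IsClosed {M : ModVariety rel d | aeval (ArrowMatrices.entries M.1) f = 0} := by
  refine isClosed_of_closure_subset fun N hN => ?_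
  exact mem_closure_iff.1 hN f (forall_mem_reps.2 fun M hM => hM)

/-- The point is outside the closure of the complement, so a polynomial separates them. Unlike
openness, its nonvanishing can be carried along families over rings. -/
theorem exists_polynomial_of_isOpen {T : Set (ModVariety rel d)} (hT : IsOpen T)
    {N : ModVariety rel d} (hN : N ∈ T) : ∃ f : MvPolynomial (ArrowIndex d d) k,
      aeval (ArrowMatrices.entries N.1) f ≠ 0 ∧
        ∀ M : ModVariety rel d, aeval (ArrowMatrices.entries M.1) f ≠ 0 → M ∈ T := by
  have h1 : N ∉ closure Tᶜ := by
    rw [hT.isClosed_compl.closure_eq]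
    exact fun h => h hN
  rw [mem_closure_iff, InClosure] at h1
  push Not at h1
  obtain ⟨f, hf, hfN⟩ := h1
  refine ⟨f, hfN, fun M hM => ?_⟩
  by_contra hMT
  exact hM (hf _ ⟨M, hMT, rfl⟩)

theorem vanishes_or_vanishes_of_isIrreducible {T : Set (ModVariety rel d)} (hT : IsIrreducible T)
    (f g : MvPolynomial (ArrowIndex d d) k)
    (hfg : ∀ M ∈ reps T, aeval M.entries (f * g) = 0) :
    (∀ M ∈ reps T, aeval M.entries f = 0) ∨
      ∀ M ∈ reps T, aeval M.entries g = 0 := by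
  rw [forall_mem_reps] at hfg ⊢
  rw [forall_mem_reps]
  refine isPreirreducible_iff_isClosed_union_isClosed.1 hT.2 _ _ (isClosed_zeros f)
    (isClosed_zeros g) fun M hM => ?_
  have := hfg M hM
  rw [map_mul, mul_eq_zero] at this
  exact this

end ModVariety

/-- The matrix of a path, with polynomial entries. -/
noncomputable def pathPolynomials (k : Type u) [Field k] {Δ : Type v} [Quiver.{v} Δ] (d : Δ → ℕ)
    {a : Δ} : {b : Δ} → Quiver.Path a b →
      Matrix (Fin (d b)) (Fin (d a)) (MvPolynomial (ArrowIndex d d) k)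
  | _, .nil => 1
  | _, .cons σ α => (ArrowMatrices.ofEntries X : ArrowMatrices (MvPolynomial (ArrowIndex d d) k) d d)
      _ _ α * pathPolynomials k d σ

variable {k : Type u} {Δ : Type v} [Quiver.{v} Δ] [Field k] {d d' d'' : Δ → ℕ}

theorem pathPolynomials_map (M : RepSpace k d) {a b : Δ} (σ : Quiver.Path a b) :
    (pathPolynomials k d σ).map (aeval (ArrowMatrices.entries M)) = M.pathMatrix σ := by
  induction σ with
  | nil => simp [pathPolynomials, RepSpace.pathMatrix]
  | cons σ α ih =>
    rw [pathPolynomials, RepSpace.pathMatrix, Matrix.map_mul, ih]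
    congr 1
    ext r s
    simp [ArrowMatrices.ofEntries, ArrowMatrices.entries]

/-- The entries of `M_ρ` are polynomials in those of `M`. Limits constructed in the affine space are
therefore points of the module variety. -/
theorem relMatrix_eq_zero_of_inClosure {U : Set (ArrowMatrices k d d)} {a b : Δ}
    (ρ : Quiver.Path a b →₀ k) (hU : ∀ M ∈ U, RepSpace.relMatrix M ρ = 0)
    {N : ArrowMatrices k d d} (hN : InClosure U N) : RepSpace.relMatrix N ρ = 0 := by
  ext r s
  have key : ∀ M : ArrowMatrices k d d,
      aeval M.entries (∑ σ ∈ ρ.support, C (ρ σ) * pathPolynomials k d σ r s) =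
        RepSpace.relMatrix M ρ r s := by
    intro M
    simp only [RepSpace.relMatrix, Finsupp.sum, Matrix.sum_apply, map_sum, map_mul,
      ← pathPolynomials_map]
    simp
  rw [← key]
  refine hN _ fun M hM => ?_
  rw [key, hU M hM]
  rfl

theorem Intertwines.pathMatrix {f : VertexMatrices k d d'} {M : RepSpace k d} {N : RepSpace k d'}
    (hf : Intertwines f M N) {a b : Δ} (σ : Quiver.Path a b) :
    N.pathMatrix σ * f a = f b * M.pathMatrix σ := by
  induction σ with
  | nil => simp [RepSpace.pathMatrix]
  | cons σ α ih =>
    rw [RepSpace.pathMatrix, RepSpace.pathMatrix, Matrix.mul_assoc, ih, ← Matrix.mul_assoc,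
      hf, Matrix.mul_assoc]

theorem Intertwines.relMatrix_eq_zero {J : VertexMatrices k d d'} {q : VertexMatrices k d' d}
    {M : RepSpace k d} {N : RepSpace k d'} (hJ : Intertwines J M N) (hq : ∀ x, q x * J x = 1)
    {a b : Δ} (ρ : Quiver.Path a b →₀ k) (hN : N.relMatrix ρ = 0) : M.relMatrix ρ = 0 := by
  have h1 : N.relMatrix ρ * J a = J b * M.relMatrix ρ := by
    simp only [RepSpace.relMatrix, Finsupp.sum, Matrix.sum_mul, Matrix.mul_sum, Matrix.smul_mul,
      Matrix.mul_smul, hJ.pathMatrix]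
  rw [hN, Matrix.zero_mul] at h1
  rw [← Matrix.one_mul (M.relMatrix ρ), ← hq b, Matrix.mul_assoc, ← h1, Matrix.mul_zero]

end Topology

/-! ## Morphisms of representations and homomorphisms of modules -/

section Modules

variable {k : Type u} {Δ : Type v} [Quiver.{v} Δ] [Field k]
  {rel : ∀ a b : Δ, Set (Quiver.Path a b →₀ k)} {d d' d'' : Δ → ℕ} [Fintype Δ] [DecidableEq Δ]

namespace ModVariety

/-- A morphism of representations, as a homomorphism of modules. -/
noncomputable def homOfIntertwines {M : ModVariety rel d} {N : ModVariety rel d'}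
    (f : VertexMatrices k d d') (hf : Intertwines f M.1 N.1) :
    M.Carrier →ₗ[BoundPathAlgebra rel] N.Carrier where
  toFun m := fun x => (f x).mulVec (m x)
  map_add' m m' := funext fun x => Matrix.mulVec_add (f x) (m x) (m' x)
  map_smul' r m := by
    obtain ⟨y, rfl⟩ := RingCon.mk'_surjective _ r
    let F : (∀ x, Fin (d x) → k) →ₗ[k] (∀ x, Fin (d' x) → k) :=
      LinearMap.pi fun x => (f x).mulVecLin ∘ₗ LinearMap.proj x
    have key : LinearMap.llcomp k _ _ _ F ∘ₗ M.1.act.toLinearMap =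
        LinearMap.lcomp k _ F ∘ₗ N.1.act.toLinearMap := by
      refine PathAlgebra.hom_ext fun a b σ => LinearMap.ext fun m => ?_
      change F (M.1.act (PathAlgebra.ofPath σ) m) = N.1.act (PathAlgebra.ofPath σ) (F m)
      rw [RepSpace.act_ofPath, RepSpace.act_ofPath]
      funext x
      by_cases hx : x = b
      · subst hx
        simp [F, RepSpace.pathEnd, Matrix.mulVec_mulVec, hf.pathMatrix σ]
      · simp [F, RepSpace.pathEnd, Pi.single_eq_of_ne hx]
    exact LinearMap.congr_fun (LinearMap.congr_fun key y) m

theorem homOfIntertwines_apply {M : ModVariety rel d} {N : ModVariety rel d'}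
    (f : VertexMatrices k d d') (hf : Intertwines f M.1 N.1) (m : M.Carrier) (x : Δ) :
    homOfIntertwines f hf m x = (f x).mulVec (m x) := rfl

theorem homOfIntertwines_comp_apply {L : ModVariety rel d} {M : ModVariety rel d'}
    {N : ModVariety rel d''} (f : VertexMatrices k d d') (hf : Intertwines f L.1 M.1)
    (g : VertexMatrices k d' d'') (hg : Intertwines g M.1 N.1) (m : L.Carrier) :
    homOfIntertwines g hg (homOfIntertwines f hf m) = homOfIntertwines _ (hg.comp hf) m :=
  funext fun x => Matrix.mulVec_mulVec (m x) (g x) (f x)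

theorem homOfIntertwines_of_eq_one {M : ModVariety rel d} (f : VertexMatrices k d d)
    (hf : Intertwines f M.1 M.1) (h1 : ∀ x, f x = 1) (m : M.Carrier) :
    homOfIntertwines f hf m = m := funext fun x => by
  rw [homOfIntertwines_apply, h1, Matrix.one_mulVec]

/-- Isomorphic representations define isomorphic modules. -/
noncomputable def equivOfIntertwines {M : ModVariety rel d} {N : ModVariety rel d'}
    (f : VertexMatrices k d d') (hf : Intertwines f M.1 N.1)
    (g : VertexMatrices k d' d) (hg : Intertwines g N.1 M.1)
    (hfg : ∀ x, f x * g x = 1) (hgf : ∀ x, g x * f x = 1) :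
    M.Carrier ≃ₗ[BoundPathAlgebra rel] N.Carrier :=
  LinearEquiv.ofLinearMap (homOfIntertwines f hf) (homOfIntertwines g hg)
    (LinearMap.ext fun m => by
      rw [LinearMap.comp_apply, homOfIntertwines_comp_apply]
      exact homOfIntertwines_of_eq_one _ _ hfg m)
    (LinearMap.ext fun m => by
      rw [LinearMap.comp_apply, homOfIntertwines_comp_apply]
      exact homOfIntertwines_of_eq_one _ _ hgf m)

/-- Every homomorphism of modules comes from a morphism of representations. -/
theorem exists_intertwines {M : ModVariety rel d} {N : ModVariety rel d'}
    (φ : M.Carrier →ₗ[BoundPathAlgebra rel] N.Carrier) :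
    ∃ (f : VertexMatrices k d d') (hf : Intertwines f M.1 N.1), φ = homOfIntertwines f hf := by
  let Φ : (∀ x, Fin (d x) → k) →ₗ[k] (∀ x, Fin (d' x) → k) := φ.restrictScalars k
  -- Trivial paths show that `Φ` is block diagonal over the vertices; paths of length one show that
  -- the blocks commute with the arrows.
  have hpath : ∀ {a b : Δ} (σ : Quiver.Path a b) (m : ∀ x, Fin (d x) → k),
      Φ (Pi.single b ((M.1.pathMatrix σ).mulVec (m a))) =
        Pi.single b ((N.1.pathMatrix σ).mulVec (Φ m a)) := by
    intro a b σ m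
    have h1 : Φ (M.1.act (PathAlgebra.ofPath σ) m) = N.1.act (PathAlgebra.ofPath σ) (Φ m) :=
      φ.map_smul ((TwoSidedIdeal.span (relationSet rel)).ringCon.mk' (PathAlgebra.ofPath σ)) m
    rw [RepSpace.act_ofPath, RepSpace.act_ofPath] at h1
    exact h1
  let f : VertexMatrices k d d' := fun x =>
    LinearMap.toMatrix' (LinearMap.proj x ∘ₗ Φ ∘ₗ LinearMap.single k (fun x => Fin (d x) → k) x)
  have hf : ∀ x w, (f x).mulVec w = Φ (Pi.single x w) x := fun x w => by
    simp only [f]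
    rw [← Matrix.toLin'_apply, Matrix.toLin'_toMatrix']
    rfl
  refine ⟨f, fun a b α => ?_, LinearMap.ext fun m => funext fun x => ?_⟩
  · refine Matrix.ext_of_mulVec_single fun r => ?_
    have h1 := congrFun (hpath (Quiver.Path.nil.cons α) (Pi.single a (Pi.single r 1))) b
    simp only [RepSpace.pathMatrix, Matrix.mul_one, Pi.single_eq_same] at h1
    rw [← Matrix.mulVec_mulVec, ← Matrix.mulVec_mulVec, hf, hf, ← h1]
  · have h1 := congrFun (hpath (Quiver.Path.nil : Quiver.Path x x) m) x
    simp only [RepSpace.pathMatrix, Matrix.one_mulVec, Pi.single_eq_same] at h1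
    exact ((hf x (m x)).trans h1).symm

theorem eq_of_homOfIntertwines_apply_eq {M : ModVariety rel d} {N : ModVariety rel d'}
    {f g : VertexMatrices k d d'} (hf : Intertwines f M.1 N.1) (hg : Intertwines g M.1 N.1)
    (h : ∀ m, homOfIntertwines f hf m = homOfIntertwines g hg m) (x : Δ) : f x = g x := by
  refine Matrix.ext_of_mulVec_single fun r => ?_
  have h1 : (f x).mulVec ((Pi.single x (Pi.single r 1) : ∀ x, Fin (d x) → k) x) =
      (g x).mulVec ((Pi.single x (Pi.single r 1) : ∀ x, Fin (d x) → k) x) :=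
    congrFun (h (Pi.single x (Pi.single r 1) : ∀ x, Fin (d x) → k)) x
  rwa [Pi.single_eq_same] at h1

end ModVariety

end Modules

/-! ## Decompositions and degenerations of the points of the module varieties -/

section Main

variable {k : Type u} {Δ : Type v} [Quiver.{v} Δ] [Field k]
  {rel : ∀ a b : Δ, Set (Quiver.Path a b →₀ k)} {d d' d'' : Δ → ℕ}

namespace ModVariety

/-- A family isomorphic to a point of the module variety satisfies the relations. -/
def ofLeftInverse (N : ModVariety rel d) (M : ArrowMatrices k d' d') (J : VertexMatrices k d' d)
    (q : VertexMatrices k d d') (hJ : Intertwines J M N.1) (hq : ∀ x, q x * J x = 1) :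
    ModVariety rel d' :=
  ⟨M, fun a b ρ hρ => hJ.relMatrix_eq_zero hq ρ (N.2 a b ρ hρ)⟩

theorem mem_orbit_iff {M N : ModVariety rel d} : N ∈ M.orbit ↔
    ∃ g g' : VertexMatrices k d d, (∀ x, g x * g' x = 1) ∧ Intertwines g M.1 N.1 := by
  constructor
  · rintro ⟨g, hg⟩
    refine ⟨fun x => (g x).1, fun x => ((g x)⁻¹).1, fun x => (g x).mul_inv, fun a b α => ?_⟩
    have h1 : ((g a)⁻¹).1 * (g a).1 = 1 := (g a).inv_mul
    rw [hg, Matrix.mul_assoc, h1, Matrix.mul_one]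
  · rintro ⟨g, g', hg, h⟩
    refine ⟨fun x => ⟨g x, g' x, hg x, mul_eq_one_comm.1 (hg x)⟩, fun a b α => ?_⟩
    exact congrFun (congrFun (congrFun (h.eq_mul hg) a) b) α

theorem mem_orbit_self (M : ModVariety rel d) : M ∈ M.orbit :=
  mem_orbit_iff.2 ⟨fun _ => 1, fun _ => 1, fun _ => Matrix.one_mul 1, intertwines_one _⟩

theorem isStable_reps {T : Set (ModVariety rel d)} (hT : ∀ M ∈ T, M.orbit ⊆ T) :
    IsStable (reps T) := by
  rintro _ N g g' hg h ⟨M, hM, rfl⟩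
  exact ⟨M.ofLeftInverse N g' g (h.inverse hg) hg, hT M hM (mem_orbit_iff.2 ⟨g, g', hg, h⟩), rfl⟩

theorem orbit_subset_orbit {M N : ModVariety rel d} (hN : N ∈ M.orbit) : N.orbit ⊆ M.orbit := by
  intro L hL
  obtain ⟨g, g', hg, h⟩ := mem_orbit_iff.1 hN
  obtain ⟨f, f', hf, h'⟩ := mem_orbit_iff.1 hL
  refine mem_orbit_iff.2 ⟨_, fun x => g' x * f' x, fun x => ?_, h'.comp h⟩
  rw [Matrix.mul_assoc, ← Matrix.mul_assoc (g x), hg, Matrix.one_mul, hf]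

/-- A direct sum lies in every orbit closure that contains an extension of its summands. -/
theorem mem_closure_orbit_of_extension [Infinite k] {N N' M : ModVariety rel d}
    (S : Splitting k d d' d'') (u : ArrowMatrices k d' d') (z : ArrowMatrices k d'' d')
    (v : ArrowMatrices k d'' d'') (hN : N.1 = S.assemble u 0 0 v) (hN' : N'.1 = S.assemble u z 0 v)
    (h : N' ∈ closure M.orbit) : N ∈ closure M.orbit := by
  have hst : IsStable (reps M.orbit) := isStable_reps fun L hL => orbit_subset_orbit hL
  rw [mem_closure_iff] at h ⊢
  -- The extension is only known to lie in the orbit closure, so the degeneration is applied to that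
  -- closure, which is again stable.
  have h1 := S.inClosure_assemble_zero u z v {L | InClosure (reps M.orbit) L}
    (fun L L' g g' hg hi hL => hst.inClosure hg hi hL) (by rwa [← hN'])
  rw [hN]
  exact fun f hf => h1 f fun L hL => hL f hf

end ModVariety

variable [Fintype Δ] [DecidableEq Δ]

open ModVariety

/-- Invariance under isomorphism, from `M ≅ N ⊕ 0` and closure under summands. -/
theorem ClosedUnderSumsAndSummands.of_equiv
    {L : CategoryTheory.ObjectProperty (FGModuleCat.{max u v} (BoundPathAlgebra rel))}
    (hL : ClosedUnderSumsAndSummands L) {M N : FGModuleCat.{max u v} (BoundPathAlgebra rel)}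
    (e : M ≃ₗ[BoundPathAlgebra rel] N) (hM : L M) : L N :=
  hL.summand N (FGModuleCat.of _ PUnit.{max u v + 1}) M
    ⟨e.trans (LinearEquiv.prodUnique (R := BoundPathAlgebra rel) (M := N)
      (M₂ := PUnit.{max u v + 1})).symm⟩ hM

theorem ClosedUnderSumsAndSummands.mem_pointsOf
    {L : CategoryTheory.ObjectProperty (FGModuleCat.{max u v} (BoundPathAlgebra rel))}
    (hL : ClosedUnderSumsAndSummands L) {M : ModVariety rel d} {N : ModVariety rel d'}
    (hM : M ∈ pointsOf L d) {f : VertexMatrices k d d'} (hf : Intertwines f M.1 N.1)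
    {g : VertexMatrices k d' d} (hg : Intertwines g N.1 M.1) (hfg : ∀ x, f x * g x = 1)
    (hgf : ∀ x, g x * f x = 1) : N ∈ pointsOf L d' :=
  hL.of_equiv (M := M.toModule) (N := N.toModule) (equivOfIntertwines f hf g hg hfg hgf) hM

theorem ClosedUnderSumsAndSummands.orbit_subset
    {L : CategoryTheory.ObjectProperty (FGModuleCat.{max u v} (BoundPathAlgebra rel))}
    (hL : ClosedUnderSumsAndSummands L) {M : ModVariety rel d} (hM : M ∈ pointsOf L d) :
    M.orbit ⊆ pointsOf L d := by
  intro N hN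
  obtain ⟨g, g', hg, h⟩ := mem_orbit_iff.1 hN
  exact hL.mem_pointsOf hM h (h.inverse hg) hg fun x => mul_eq_one_comm.1 (hg x)

/-- If the idempotent `sr` of `N`, which factors through the module `W`, also factors through the
representation `M`, then `M` is a model of `W`. -/
theorem nonempty_equiv_of_factorizations {M : ModVariety rel d'} {N : ModVariety rel d}
    (W : Type*) [AddCommGroup W] [Module (BoundPathAlgebra rel) W]
    (s : W →ₗ[BoundPathAlgebra rel] N.Carrier) (r : N.Carrier →ₗ[BoundPathAlgebra rel] W)
    (hrs : ∀ w, r (s w) = w) {J : VertexMatrices k d' d} (hJ : Intertwines J M.1 N.1)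
    {Q : VertexMatrices k d d'} (hQ : Intertwines Q N.1 M.1) (hQJ : ∀ x, Q x * J x = 1)
    (h : ∀ n, homOfIntertwines _ (hJ.comp hQ) n = s (r n)) :
    Nonempty (W ≃ₗ[BoundPathAlgebra rel] M.Carrier) := by
  have h' : ∀ n, homOfIntertwines J hJ (homOfIntertwines Q hQ n) = s (r n) := fun n => by
    rw [homOfIntertwines_comp_apply, h]
  have hQJ' : ∀ m, homOfIntertwines Q hQ (homOfIntertwines J hJ m) = m := fun m => by
    rw [homOfIntertwines_comp_apply, homOfIntertwines_of_eq_one _ _ hQJ]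
  refine ⟨LinearEquiv.ofLinearMap (homOfIntertwines Q hQ ∘ₗ s) (r ∘ₗ homOfIntertwines J hJ) ?_ ?_⟩
  · refine LinearMap.ext fun m => ?_
    change homOfIntertwines Q hQ (s (r (homOfIntertwines J hJ m))) = m
    rw [← h', hQJ', hQJ']
  · refine LinearMap.ext fun w => ?_
    change r (homOfIntertwines J hJ (homOfIntertwines Q hQ (s w))) = w
    rw [h', hrs, hrs]

/-- A bisection decomposes every point of the module variety into two blocks. -/
theorem exists_block_decomposition
    {L R : CategoryTheory.ObjectProperty (FGModuleCat.{max u v} (BoundPathAlgebra rel))}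
    (hLR : IsGeometricBisection L R) (N : ModVariety rel d) :
    ∃ (d' d'' : Δ → ℕ) (S : Splitting k d d' d'') (u : ModVariety rel d') (v : ModVariety rel d''),
      N.1 = S.assemble u.1 0 0 v.1 ∧ u ∈ pointsOf L d' ∧ v ∈ pointsOf R d'' := by
  obtain ⟨U, V, hU, hV, ⟨Φ⟩⟩ := hLR.decomposition N.toModule
  let Ψ : N.Carrier ≃ₗ[BoundPathAlgebra rel] U × V := Φ
  let sU : U →ₗ[BoundPathAlgebra rel] N.Carrier := Ψ.symm.toLinearMap ∘ₗ LinearMap.inl _ U V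
  let rU : N.Carrier →ₗ[BoundPathAlgebra rel] U := LinearMap.fst _ U V ∘ₗ Ψ.toLinearMap
  let sV : V →ₗ[BoundPathAlgebra rel] N.Carrier := Ψ.symm.toLinearMap ∘ₗ LinearMap.inr _ U V
  let rV : N.Carrier →ₗ[BoundPathAlgebra rel] V := LinearMap.snd _ U V ∘ₗ Ψ.toLinearMap
  have hrsU : ∀ w, rU (sU w) = w := fun w => by simp [rU, sU]
  have hrsV : ∀ w, rV (sV w) = w := fun w => by simp [rV, sV]
  have hsum : ∀ n, sU (rU n) + sV (rV n) = n := fun n => by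
    change Ψ.symm ((Ψ n).1, 0) + Ψ.symm (0, (Ψ n).2) = n
    rw [← map_add, Prod.mk_add_mk, add_zero, zero_add, LinearEquiv.symm_apply_apply]
  -- The projection of `N` onto `V` becomes an idempotent at each vertex. Its image and that of `1 -
  -- e` supply the dimension vectors and the bases of the two blocks.
  obtain ⟨e, he, hφ⟩ := exists_intertwines (sV ∘ₗ rV)
  have hφ' : ∀ n, homOfIntertwines e he n = sV (rV n) := fun n => by rw [← hφ]; rfl
  have hidem : ∀ x, e x * e x = e x := eq_of_homOfIntertwines_apply_eq (he.comp he) he fun n => by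
    rw [← homOfIntertwines_comp_apply e he e he, hφ', hφ', hrsV]
  obtain ⟨d', d'', S, hS⟩ := exists_splitting_of_idempotent e hidem
  have hS' : ∀ x, S.i x * S.p x = 1 - e x := fun x => by
    rw [← S.add x, hS, add_sub_cancel_right]
  -- the idempotents split off the blocks
  have hJ : Intertwines S.j (fun a b α => S.q b * (N.1 a b α * S.j a)) N.1 := fun a b α => by
    rw [← Matrix.mul_assoc, hS, ← Matrix.mul_assoc, ← he a b α, ← hS, Matrix.mul_assoc,
      Matrix.mul_assoc, S.q_j, Matrix.mul_one]
  have hQ : Intertwines S.q N.1 (fun a b α => S.q b * (N.1 a b α * S.j a)) := fun a b α => by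
    rw [Matrix.mul_assoc, Matrix.mul_assoc, hS, he a b α, ← hS, ← Matrix.mul_assoc,
      ← Matrix.mul_assoc, S.q_j, Matrix.one_mul]
  have he' : ∀ {a b : Δ} (α : a ⟶ b),
      N.1 a b α * (S.i a * S.p a) = S.i b * S.p b * N.1 a b α := fun {a b} α => by
    rw [hS', hS', Matrix.mul_sub, Matrix.sub_mul, he a b α, Matrix.mul_one, Matrix.one_mul]
  have hI : Intertwines S.i (fun a b α => S.p b * (N.1 a b α * S.i a)) N.1 := fun a b α => by
    rw [← Matrix.mul_assoc, ← Matrix.mul_assoc, ← he' α, Matrix.mul_assoc, Matrix.mul_assoc,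
      S.p_i, Matrix.mul_one]
  have hP : Intertwines S.p N.1 (fun a b α => S.p b * (N.1 a b α * S.i a)) := fun a b α => by
    rw [Matrix.mul_assoc, Matrix.mul_assoc, he' α, ← Matrix.mul_assoc, ← Matrix.mul_assoc, S.p_i,
      Matrix.one_mul]
  let u : ModVariety rel d' := N.ofLeftInverse _ S.i S.p hI S.p_i
  let v : ModVariety rel d'' := N.ofLeftInverse _ S.j S.q hJ S.q_j
  refine ⟨d', d'', S, u, v, ?_, ?_, ?_⟩
  · funext a b α
    calc N.1 a b α = N.1 a b α * (S.i a * S.p a + S.j a * S.q a) := by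
          rw [S.add, Matrix.mul_one]
      _ = S.i b * u.1 a b α * S.p a + S.j b * v.1 a b α * S.q a := by
          rw [Matrix.mul_add, ← Matrix.mul_assoc, ← Matrix.mul_assoc, hI a b α, hJ a b α]
          rfl
      _ = _ := by
          simp [Splitting.assemble, Matrix.mul_assoc]
  · obtain ⟨f⟩ := nonempty_equiv_of_factorizations (M := u) U sU rU hrsU hI hP S.p_i fun n => by
      rw [← add_left_inj (sV (rV n)), hsum, ← hφ']
      funext x
      change (S.i x * S.p x).mulVec (n x) + (e x).mulVec (n x) = n x
      rw [hS', ← Matrix.add_mulVec, sub_add_cancel, Matrix.one_mulVec]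
    exact hLR.closed_left.of_equiv (N := u.toModule) f hU
  · obtain ⟨f⟩ := nonempty_equiv_of_factorizations (M := v) V sV rV hrsV hJ hQ S.q_j fun n => by
      rw [← hφ']
      funext x
      change (S.j x * S.q x).mulVec (n x) = (e x).mulVec (n x)
      rw [hS]
    exact hLR.closed_right.of_equiv (N := v.toModule) f hV

/-- A morphism from a point of `R` to a point of `L` is zero. -/
theorem IsGeometricBisection.intertwines_eq_zero
    {L R : CategoryTheory.ObjectProperty (FGModuleCat.{max u v} (BoundPathAlgebra rel))}
    (hLR : IsGeometricBisection L R) {M : ModVariety rel d} (hM : M ∈ pointsOf L d)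
    {N : ModVariety rel d'} (hN : N ∈ pointsOf R d') {f : VertexMatrices k d' d}
    (hf : Intertwines f N.1 M.1) (x : Δ) : f x = 0 := by
  have h0 : homOfIntertwines f hf = 0 :=
    hLR.hom_eq_zero M.toModule N.toModule hM hN (homOfIntertwines f hf)
  refine eq_of_homOfIntertwines_apply_eq hf (g := 0) (homSpace N.1 M.1).zero_mem (fun m => ?_) x
  rw [h0]
  funext y
  exact (Matrix.zero_mulVec (m y)).symm

/-- The summand of `N` in `R` is traded for a nonsplit extension with fewer endomorphisms until it
disappears. -/
theorem exists_mem_closure_orbit [IsAlgClosed k] [∀ a b : Δ, Fintype (a ⟶ b)]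
    {L R : CategoryTheory.ObjectProperty (FGModuleCat.{max u v} (BoundPathAlgebra rel))}
    (hLR : IsGeometricBisection L R) (hd : (pointsOf L d).Nonempty) (N : ModVariety rel d)
    (hN : N ∈ closure (pointsOf L d)) : ∃ M ∈ pointsOf L d, N ∈ closure M.orbit := by
  have : Infinite k := IsAlgClosed.instInfinite
  induction hn : Module.finrank k (homSpace N.1 N.1) using Nat.strong_induction_on generalizing N with
  | _ n ih =>
  obtain ⟨d', d'', S, u, v, hNS, hu, hv⟩ := exists_block_decomposition hLR N
  by_cases hd'' : ∀ x, d'' x = 0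
  · refine ⟨N, ?_, subset_closure N.mem_orbit_self⟩
    have hj : ∀ x, S.j x = 0 := fun x => by
      ext r s
      exact (Fin.cast (hd'' x) s).elim0
    refine hLR.closed_left.mem_pointsOf hu (f := S.i) (g := S.p) ?_ ?_ (fun x => ?_) S.p_i
    · rw [hNS]
      exact S.intertwines_i _ _ _
    · rw [hNS]
      exact S.intertwines_p _ _
    · rw [← S.add x, hj, Matrix.zero_mul, add_zero]
  · push Not at hd''
    obtain ⟨x₀, hx₀⟩ := hd''
    obtain ⟨M₀, hM₀⟩ := hd
    obtain ⟨f₀, hf₀, hf₀L⟩ := exists_polynomial_of_isOpen (hLR.isOpen_left d) hM₀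
    obtain ⟨g₀, hg₀, hg₀R⟩ := exists_polynomial_of_isOpen (hLR.isOpen_right d'') hv
    have hN' := ModVariety.mem_closure_iff.1 hN
    have hrel : ∀ {M : ArrowMatrices k d d}, InClosure (reps (pointsOf L d)) M →
        ∀ (a b : Δ), ∀ ρ ∈ rel a b, RepSpace.relMatrix M ρ = 0 := fun hM a b ρ hρ =>
      relMatrix_eq_zero_of_inClosure ρ (forall_mem_reps.2 fun M' _ => M'.2 a b ρ hρ) hM
    obtain ⟨ζ, hζ, hne⟩ := exists_nonsplit_extension_inClosure (reps (pointsOf L d))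
      (isStable_reps fun M hM => hLR.closed_left.orbit_subset hM)
      (vanishes_or_vanishes_of_isIrreducible (hLR.irreducible_left d ⟨M₀, hM₀⟩)) S u.1 v.1
      (hNS ▸ hN') (fun h hh => funext fun x => hLR.intertwines_eq_zero hu hv hh x) f₀
      ⟨M₀.1, ⟨M₀, hM₀, rfl⟩, hf₀⟩ g₀ hg₀ (by
        intro M hM hMf b hb J hJ hq
        have hML : (⟨M, hrel hM⟩ : ModVariety rel d) ∈ pointsOf L d := hf₀L _ hMf
        let b' := ofLeftInverse (⟨M, hrel hM⟩ : ModVariety rel d) b J S.q hJ hq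
        -- The choices of `f₀` and `g₀` put `M` in `L` and its subrepresentation `b` in `R`. The
        -- embedding `J` is then zero, although `qJ = 1` on a nonzero space at `x₀`.
        have hJ0 := hLR.intertwines_eq_zero hML (N := b') (hg₀R b' hb) hJ x₀
        have h1 := hq x₀
        rw [hJ0, Matrix.mul_zero] at h1
        exact zero_ne_one (congrFun (congrFun h1 ⟨0, Nat.pos_of_ne_zero hx₀⟩)
          ⟨0, Nat.pos_of_ne_zero hx₀⟩ |>.trans (Matrix.one_apply_eq _)))
    let N₁ : ModVariety rel d := ⟨S.assemble u.1 ζ 0 v.1, hrel hζ⟩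
    obtain ⟨M, hM, hN₁M⟩ := ih _ (by rw [← hn, hNS]; exact finrank_end_lt S u.1 ζ v.1 hne) N₁
      (ModVariety.mem_closure_iff.2 hζ) rfl
    exact ⟨M, hM, mem_closure_orbit_of_extension S u.1 ζ v.1 hNS rfl hN₁M⟩

end Main

theorem mainTheorem4 {k : Type u} [Field k] [IsAlgClosed k]
    {Δ : Type v} [Quiver.{v} Δ] [Fintype Δ] [DecidableEq Δ] [∀ a b : Δ, Fintype (a ⟶ b)]
    (rel : ∀ a b : Δ, Set (Quiver.Path a b →₀ k)) (hrel : IsBoundQuiver rel)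
    (L R : CategoryTheory.ObjectProperty (FGModuleCat.{max u v} (BoundPathAlgebra rel)))
    (hLR : IsGeometricBisection L R)
    {X : Type*} (H : X → FGModuleCat.{max u v} (BoundPathAlgebra rel))
    (hH : IsDeterminedBy L R H)
    (d : Δ → ℕ) (hd : (pointsOf L d).Nonempty) :
    (∀ N ∈ closure (pointsOf L d), ∃ M ∈ pointsOf L d, N ∈ closure M.orbit) ∧
      closure (pointsOf L d) = ⋃ M ∈ pointsOf L d, closure M.orbit := by
  have key := exists_mem_closure_orbit hLR hd
  refine ⟨key, Set.Subset.antisymm (fun N hN => ?_) (Set.iUnion₂_subset fun M hM => ?_)⟩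
  · obtain ⟨M, hM, hNM⟩ := key N hN
    exact Set.mem_iUnion₂.2 ⟨M, hM, hNM⟩
  · exact closure_mono (hLR.closed_left.orbit_subset hM)
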